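/- Let $d\in\mathbb N$ and $1\le q<\infty$, and let $q'=\frac{q}{q-1}$ be the conjugate exponent ($q'=\infty$ if $q=1$). For a function $g$ on $\mathbb{R}^d$ write $$\mathcal M(g)=\lim_{T\to\infty}\frac1{(2T)^d}\int_{[-T,T]^d}g(\boldsymbol x)\,d\boldsymbol x$$ for its Bohr mean, when the limit exists. Let $\mathcal T(\mathbb{R}^d)$ be the space of trigonometric polynomials, that is, the finite complex linear combinations of the functions $\boldsymbol x\mapsto e^{i\boldsymbol\lambda^T\boldsymbol x}$, $\boldsymbol\lambda\in\mathbb{R}^d$. For $S\in\mathcal T(\mathbb{R}^d)$ put $\|S\|_q=\mathcal M(|S|^q)^{1/q}$ and $\widehat S(\boldsymbol\lambda)=\mathcal M\big(S(\boldsymbol x)e^{-i\boldsymbol\lambda^T\boldsymbol x}\big)$ for $\boldsymbol\lambda\in\mathbb{R}^d$ (these means exist). Let $B^q_{ap}(\mathbb{R}^d)$, the space of Besicovitch almost periodic functions of order $q$, be the completion of $\mathcal T(\mathbb{R}^d)$ with respect to $\|\cdot\|_q$, whose norm is again denoted by $\|\cdot\|_q$. For $f\in B^q_{ap}(\mathbb{R}^d)$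 let $\widehat f(\boldsymbol\lambda)=\lim_{n\to\infty}\widehat{S_n}(\boldsymbol\lambda)$, where $(S_n)$ is any sequence of trigonometric polynomials tending to $f$, and let $\sigma_f=\{\boldsymbol\lambda\in\mathbb{R}^d:\widehat f(\boldsymbol\lambda)\ne0\}$. Then for every $f\in B^q_{ap}(\mathbb{R}^d)$ the following hold. (a) If $1\le q\le2$, then $$\Big(\sum_{\boldsymbol\lambda\in\sigma_f}|\widehat f(\boldsymbol\lambda)|^{q'}\Big)^{1/q'}\le\|f\|_q .$$ (b) If $2\le q<\infty$, then $$\|f\|_q\le\Big(\sum_{\boldsymbol\lambda\in\sigma_f}|\widehat f(\boldsymbol\lambda)|^{q'}\Big)^{1/q'},$$ where the right-hand side may be $+\infty$. For $q=1$ the left-hand side in (a) means $\sup_{\boldsymbol\lambda\in\sigma_f}|\widehat f(\boldsymbol\lambda)|$ (equal to $0$ if $\sigma_f=\emptyset$). -/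

import Mathlib

open MeasureTheory Filter Topology
open scoped ENNReal NNReal

noncomputable section

namespace BesicovitchAP

/-- The average `(2T)⁻ᵈ ∫_{[-T,T]ᵈ} g(x) dx` over a cube; `ℝᵈ` is `Fin d → ℝ` with Lebesgue measure. -/
def cubeAvg {d : ℕ} {E : Type*} [NormedAddCommGroup E] [NormedSpace ℝ E]
    (g : (Fin d → ℝ) → E) (T : ℝ) : E :=
  ((2 * T) ^ d)⁻¹ • ∫ x in Set.Icc (fun _ : Fin d => -T) (fun _ : Fin d => T), g x

/-- The Bohr mean `𝓜(g) = lim_{T → ∞} (2T)⁻ᵈ ∫_{[-T,T]ᵈ} g(x) dx`. -/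
def bohrMean {d : ℕ} {E : Type*} [NormedAddCommGroup E] [NormedSpace ℝ E]
    (g : (Fin d → ℝ) → E) : E :=
  limUnder atTop (cubeAvg g)

/-- The character `x ↦ exp(i ξᵀ x)` of `ℝᵈ`. -/
def character {d : ℕ} (ξ : Fin d → ℝ) (x : Fin d → ℝ) : ℂ :=
  Complex.exp (Complex.I * ((ξ ⬝ᵥ x : ℝ) : ℂ))

/-- The complex vector space of trigonometric polynomials on `ℝᵈ`. -/
def trigPoly (d : ℕ) : Submodule ℂ ((Fin d → ℝ) → ℂ) :=
  Submodule.span ℂ (Set.range character)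

/-- The Fourier coefficient `Ŝ(ξ) = 𝓜(S(x) exp(-i ξᵀ x))` of a function on `ℝᵈ`. -/
def polyCoeff {d : ℕ} (S : (Fin d → ℝ) → ℂ) (ξ : Fin d → ℝ) : ℂ :=
  bohrMean fun x => S x * Complex.exp (-(Complex.I * ((ξ ⬝ᵥ x : ℝ) : ℂ)))

/-- The Besicovitch norm `‖S‖_q = 𝓜(|S|^q)^{1/q}`. -/
def besicovitchNorm {d : ℕ} (q : ℝ) (S : (Fin d → ℝ) → ℂ) : ℝ :=
  (bohrMean fun x => ‖S x‖ ^ q) ^ (1 / q)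

/-! ### The limits exist on trigonometric polynomials -/

lemma continuous_character {d : ℕ} (ξ : Fin d → ℝ) : Continuous (character ξ) := by
  unfold character dotProduct
  fun_prop

lemma norm_character {d : ℕ} (ξ x : Fin d → ℝ) : ‖character ξ x‖ = 1 := by
  unfold character
  rw [mul_comm, Complex.norm_exp_ofReal_mul_I]

lemma character_mul {d : ℕ} (ξ η : Fin d → ℝ) :
    character ξ * character η = character (ξ + η) := by
  funext x
  simp only [Pi.mul_apply, character, ← Complex.exp_add, add_dotProduct]
  push_cast
  ring_nf

lemma conj_character {d : ℕ} (ξ : Fin d → ℝ) :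
    (fun x => (starRingEnd ℂ) (character ξ x)) = character (-ξ) := by
  funext x
  simp [character, ← Complex.exp_conj]

lemma character_zero {d : ℕ} : (character (0 : Fin d → ℝ)) = 1 := by
  funext x
  simp [character]

lemma character_mem {d : ℕ} (ξ : Fin d → ℝ) : character ξ ∈ trigPoly d :=
  Submodule.subset_span ⟨ξ, rfl⟩

lemma continuous_of_mem {d : ℕ} {S : (Fin d → ℝ) → ℂ} (hS : S ∈ trigPoly d) :
    Continuous S := by
  induction hS using Submodule.span_induction with
  | mem x h => obtain ⟨ξ, rfl⟩ := h; exact continuous_character ξ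
  | zero => exact continuous_const
  | add x y _ _ hx hy => exact hx.add hy
  | smul a x _ hx => exact hx.const_smul a

lemma bounded_of_mem {d : ℕ} {S : (Fin d → ℝ) → ℂ} (hS : S ∈ trigPoly d) :
    ∃ C, ∀ x, ‖S x‖ ≤ C := by
  induction hS using Submodule.span_induction with
  | mem x h => obtain ⟨ξ, rfl⟩ := h; exact ⟨1, fun x => (norm_character ξ x).le⟩
  | zero => exact ⟨0, by simp⟩
  | add x y _ _ hx hy =>
    obtain ⟨A, hA⟩ := hx
    obtain ⟨B, hB⟩ := hy
    exact ⟨A + B, fun t => (norm_add_le _ _).trans (add_le_add (hA t) (hB t))⟩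
  | smul a x _ hx =>
    obtain ⟨A, hA⟩ := hx
    refine ⟨‖a‖ * A, fun t => ?_⟩
    rw [Pi.smul_apply, norm_smul]
    exact mul_le_mul_of_nonneg_left (hA t) (norm_nonneg _)

lemma mul_mem {d : ℕ} {S R : (Fin d → ℝ) → ℂ} (hS : S ∈ trigPoly d) (hR : R ∈ trigPoly d) :
    S * R ∈ trigPoly d := by
  have h : trigPoly d * trigPoly d ≤ trigPoly d := by
    unfold trigPoly
    rw [Submodule.span_mul_span]
    refine Submodule.span_mono ?_
    rintro _ ⟨_, ⟨ξ, rfl⟩, _, ⟨η, rfl⟩, rfl⟩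
    exact ⟨ξ + η, (character_mul ξ η).symm⟩
  exact h (Submodule.mul_mem_mul hS hR)

lemma conj_mem {d : ℕ} {S : (Fin d → ℝ) → ℂ} (hS : S ∈ trigPoly d) :
    (fun x => (starRingEnd ℂ) (S x)) ∈ trigPoly d := by
  induction hS using Submodule.span_induction with
  | mem x h => obtain ⟨ξ, rfl⟩ := h; rw [conj_character]; exact character_mem _
  | zero =>
    have h : (fun x : Fin d → ℝ => (starRingEnd ℂ) ((0 : (Fin d → ℝ) → ℂ) x)) = 0 := by
      funext x
      simp
    rw [h]
    exact (trigPoly d).zero_mem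
  | add x y _ _ hx hy =>
    simp only [Pi.add_apply, map_add]
    exact (trigPoly d).add_mem hx hy
  | smul a x _ hx =>
    simp only [Pi.smul_apply, smul_eq_mul, map_mul]
    exact (trigPoly d).smul_mem _ hx

lemma one_mem {d : ℕ} : (1 : (Fin d → ℝ) → ℂ) ∈ trigPoly d := by
  rw [← character_zero]; exact character_mem 0

lemma pow_mem {d : ℕ} {S : (Fin d → ℝ) → ℂ} (hS : S ∈ trigPoly d) (n : ℕ) :
    S ^ n ∈ trigPoly d := by
  induction n with
  | zero => rw [pow_zero]; exact one_mem
  | succ n ih => rw [pow_succ]; exact mul_mem ih hS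

section avg

variable {d : ℕ} {E : Type*} [NormedAddCommGroup E]

lemma integrableOn_cube {g : (Fin d → ℝ) → E} (hg : Continuous g) (T : ℝ) :
    IntegrableOn g (Set.Icc (fun _ : Fin d => -T) (fun _ : Fin d => T)) :=
  hg.continuousOn.integrableOn_compact isCompact_Icc

/-- The uniform probability measure on the cube `[-T,T]ᵈ`. -/
def cubeMeasure (d : ℕ) (T : ℝ) : Measure (Fin d → ℝ) :=
  ENNReal.ofReal (((2 * T) ^ d)⁻¹) •
    volume.restrict (Set.Icc (fun _ : Fin d => -T) (fun _ : Fin d => T))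

lemma integrable_cube {g : (Fin d → ℝ) → E} (hg : Continuous g) (T : ℝ) :
    Integrable g (cubeMeasure d T) :=
  Integrable.smul_measure (integrableOn_cube hg T) ENNReal.ofReal_ne_top

variable [NormedSpace ℝ E]

lemma cubeAvg_add {g h : (Fin d → ℝ) → E} (hg : Continuous g) (hh : Continuous h) (T : ℝ) :
    cubeAvg (g + h) T = cubeAvg g T + cubeAvg h T := by
  unfold cubeAvg
  rw [← smul_add]
  congr 1
  exact integral_add (integrableOn_cube hg T) (integrableOn_cube hh T)

lemma cubeAvg_smul (a : ℂ) (g : (Fin d → ℝ) → ℂ) (T : ℝ) :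
    cubeAvg (a • g) T = a • cubeAvg g T := by
  unfold cubeAvg
  rw [smul_comm]
  congr 1
  exact integral_smul a _

lemma cubeAvg_eq {T : ℝ} (hT : 0 < T) (g : (Fin d → ℝ) → E) :
    cubeAvg g T = ∫ x, g x ∂(cubeMeasure d T) := by
  unfold cubeAvg cubeMeasure
  rw [integral_smul_measure, ENNReal.toReal_ofReal (by positivity)]

lemma isProbabilityMeasure_cubeMeasure {T : ℝ} (hT : 0 < T) :
    IsProbabilityMeasure (cubeMeasure d T) := by
  constructor
  unfold cubeMeasure
  rw [Measure.smul_apply, Measure.restrict_apply_univ, Real.volume_Icc_pi]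
  simp only [sub_neg_eq_add, Finset.prod_const, Finset.card_univ, Fintype.card_fin, smul_eq_mul]
  rw [← two_mul, ← ENNReal.ofReal_pow (by positivity), ← ENNReal.ofReal_mul (by positivity),
    inv_mul_cancel₀ (by positivity), ENNReal.ofReal_one]

lemma norm_cubeAvg_sub_le {g h : (Fin d → ℝ) → E} (hg : Continuous g) (hh : Continuous h)
    {ε : ℝ} (hε : ∀ x, ‖g x - h x‖ ≤ ε) {T : ℝ} (hT : 0 < T) :
    ‖cubeAvg g T - cubeAvg h T‖ ≤ ε := by
  have := isProbabilityMeasure_cubeMeasure (d := d) hT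
  rw [cubeAvg_eq hT, cubeAvg_eq hT, ← integral_sub (integrable_cube hg T) (integrable_cube hh T)]
  refine (norm_integral_le_of_norm_le_const (Eventually.of_forall hε)).trans ?_
  simp

end avg

lemma cubeAvg_character {d : ℕ} (ξ : Fin d → ℝ) (T : ℝ) :
    cubeAvg (character ξ) T =
      ∏ j, ((2 * T : ℝ) : ℂ)⁻¹ * ∫ t in Set.Icc (-T) T, Complex.exp (Complex.I * (ξ j * t : ℝ)) := by
  have h1 : character ξ = fun x => ∏ j, Complex.exp (Complex.I * (ξ j * x j : ℝ)) := by
    funext x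
    unfold character dotProduct
    rw [← Complex.exp_sum]
    push_cast
    rw [Finset.mul_sum]
  unfold cubeAvg
  rw [h1, ← Set.pi_univ_Icc, volume_pi, Measure.restrict_pi_pi,
    integral_fintype_prod_eq_prod
      (f := fun j (t : ℝ) => Complex.exp (Complex.I * (ξ j * t : ℝ)))]
  rw [Finset.prod_mul_distrib, Finset.prod_const, Finset.card_univ, Fintype.card_fin,
    Complex.real_smul]
  push_cast
  rw [inv_pow]

lemma norm_factor_le {a T : ℝ} (hT : 0 < T) :
    ‖((2 * T : ℝ) : ℂ)⁻¹ * ∫ t in Set.Icc (-T) T, Complex.exp (Complex.I * (a * t : ℝ))‖ ≤ 1 := by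
  have h : ‖∫ t in Set.Icc (-T) T, Complex.exp (Complex.I * (a * t : ℝ))‖ ≤
      1 * volume.real (Set.Icc (-T) T) := by
    refine norm_setIntegral_le_of_norm_le_const (by simp) fun t _ => ?_
    rw [mul_comm, Complex.norm_exp_ofReal_mul_I]
  rw [Real.volume_real_Icc_of_le (by linarith)] at h
  rw [norm_mul, norm_inv, Complex.norm_real, Real.norm_of_nonneg (by positivity),
    inv_mul_le_iff₀ (by positivity)]
  linarith

lemma norm_factor_le' {a T : ℝ} (ha : a ≠ 0) (hT : 0 < T) :
    ‖((2 * T : ℝ) : ℂ)⁻¹ * ∫ t in Set.Icc (-T) T, Complex.exp (Complex.I * (a * t : ℝ))‖ ≤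
      T⁻¹ * |a|⁻¹ := by
  have hc : Complex.I * (a : ℂ) ≠ 0 :=
    mul_ne_zero Complex.I_ne_zero (Complex.ofReal_ne_zero.2 ha)
  have h : ∫ t in Set.Icc (-T) T, Complex.exp (Complex.I * (a * t : ℝ)) =
      (Complex.exp (Complex.I * a * T) - Complex.exp (Complex.I * a * (-T : ℝ))) /
        (Complex.I * a) := by
    rw [integral_Icc_eq_integral_Ioc, ← intervalIntegral.integral_of_le (by linarith),
      ← integral_exp_mul_complex hc]
    congr 1
    funext t
    push_cast
    ring_nf
  have hn : ∀ s : ℝ, ‖Complex.exp (Complex.I * a * s)‖ = 1 := fun s => by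
    rw [show Complex.I * (a : ℂ) * s = ((a * s : ℝ) : ℂ) * Complex.I by push_cast; ring,
      Complex.norm_exp_ofReal_mul_I]
  rw [h, norm_mul, norm_inv, norm_div, norm_mul, Complex.norm_I, one_mul, Complex.norm_real,
    Complex.norm_real, Real.norm_of_nonneg (by positivity : (0 : ℝ) ≤ 2 * T), Real.norm_eq_abs]
  have h2 : ‖Complex.exp (Complex.I * a * T) - Complex.exp (Complex.I * a * (-T : ℝ))‖ ≤ 2 := by
    refine (norm_sub_le _ _).trans ?_
    rw [hn, hn]; norm_num
  have ha' : 0 < |a| := abs_pos.2 ha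
  calc (2 * T)⁻¹ * (_ / |a|) ≤ (2 * T)⁻¹ * (2 / |a|) := by gcongr
    _ = T⁻¹ * |a|⁻¹ := by field_simp

lemma tendsto_cubeAvg_character {d : ℕ} (ξ : Fin d → ℝ) :
    Tendsto (cubeAvg (character ξ)) atTop (𝓝 (if ξ = 0 then 1 else 0)) := by
  split_ifs with h
  · subst h
    refine tendsto_const_nhds.congr' ?_
    filter_upwards [eventually_gt_atTop 0] with T hT
    have := isProbabilityMeasure_cubeMeasure (d := d) hT
    rw [cubeAvg_eq hT, character_zero]
    simp
  · obtain ⟨j, hj⟩ : ∃ j, ξ j ≠ 0 := by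
      by_contra! hh
      exact h (funext hh)
    have hlim : Tendsto (fun T : ℝ => T⁻¹ * |ξ j|⁻¹) atTop (𝓝 0) := by
      simpa using tendsto_inv_atTop_zero.mul_const (|ξ j|⁻¹)
    refine squeeze_zero_norm' ?_ hlim
    filter_upwards [eventually_gt_atTop 0] with T hT
    rw [cubeAvg_character ξ T, norm_prod, ← Finset.mul_prod_erase _ _ (Finset.mem_univ j)]
    refine (mul_le_mul (norm_factor_le' hj hT)
      (Finset.prod_le_one (fun _ _ => norm_nonneg _) fun i _ => norm_factor_le hT)
      (Finset.prod_nonneg fun _ _ => norm_nonneg _) (by positivity)).trans ?_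
    rw [mul_one]

lemma exists_mean_of_mem {d : ℕ} {S : (Fin d → ℝ) → ℂ} (hS : S ∈ trigPoly d) :
    ∃ m, Tendsto (cubeAvg S) atTop (𝓝 m) := by
  induction hS using Submodule.span_induction with
  | mem x h => obtain ⟨ξ, rfl⟩ := h; exact ⟨_, tendsto_cubeAvg_character ξ⟩
  | zero => exact ⟨0, by
    have h : cubeAvg (0 : (Fin d → ℝ) → ℂ) = fun _ => 0 := by
      funext T
      simp [cubeAvg]
    rw [h]
    exact tendsto_const_nhds⟩
  | add x y hx hy ihx ihy =>
    obtain ⟨a, ha⟩ := ihx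
    obtain ⟨b, hb⟩ := ihy
    exact ⟨a + b, (ha.add hb).congr fun T =>
      (cubeAvg_add (continuous_of_mem hx) (continuous_of_mem hy) T).symm⟩
  | smul a x _ hx =>
    obtain ⟨b, hb⟩ := hx
    exact ⟨a • b, (hb.const_smul a).congr fun T => (cubeAvg_smul a x T).symm⟩

/-- A uniform limit of continuous functions possessing a mean has a mean. -/
lemma exists_mean_of_approx {d : ℕ} {E : Type*} [NormedAddCommGroup E] [NormedSpace ℝ E]
    [CompleteSpace E] {g : (Fin d → ℝ) → E} (hg : Continuous g)
    (h : ∀ ε > 0, ∃ r : (Fin d → ℝ) → E, Continuous r ∧ (∃ m, Tendsto (cubeAvg r) atTop (𝓝 m)) ∧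
      ∀ x, ‖g x - r x‖ ≤ ε) :
    ∃ m, Tendsto (cubeAvg g) atTop (𝓝 m) := by
  apply cauchy_map_iff_exists_tendsto.1
  rw [Metric.cauchy_iff]
  refine ⟨inferInstance, fun ε hε => ?_⟩
  obtain ⟨r, hr, ⟨m, hm⟩, hgr⟩ := h (ε / 4) (by positivity)
  refine ⟨Metric.ball m (ε / 2), ?_, fun x hx y hy => ?_⟩
  · have := (Metric.tendsto_nhds.1 hm) (ε / 4) (by positivity)
    refine mem_map.2 ?_
    filter_upwards [this, eventually_gt_atTop 0] with T hT hT0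
    have h1 := norm_cubeAvg_sub_le hg hr hgr hT0
    rw [Set.mem_preimage, Metric.mem_ball]
    rw [← dist_eq_norm] at h1
    have := dist_triangle (cubeAvg g T) (cubeAvg r T) m
    linarith
  · rw [Metric.mem_ball] at hx hy
    have := dist_triangle_right x y m
    linarith

lemma exists_mean_norm_rpow {d : ℕ} {q : ℝ} (hq : 0 ≤ q) {S : (Fin d → ℝ) → ℂ}
    (hS : S ∈ trigPoly d) :
    ∃ m, Tendsto (cubeAvg fun x => ‖S x‖ ^ q) atTop (𝓝 m) := by
  have hc := continuous_of_mem hS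
  obtain ⟨C, hC⟩ := bounded_of_mem hS
  have hC0 : 0 ≤ C := (norm_nonneg _).trans (hC 0)
  refine exists_mean_of_approx (hc.norm.rpow_const fun _ => Or.inr hq) fun ε hε => ?_
  obtain ⟨p, hp⟩ := exists_polynomial_near_of_continuousOn 0 (C ^ 2) (fun t => t ^ (q / 2))
    (Real.continuous_rpow_const (by positivity)).continuousOn ε hε
  set N : (Fin d → ℝ) → ℂ := S * fun x => (starRingEnd ℂ) (S x) with hN
  have hNm : N ∈ trigPoly d := mul_mem hS (conj_mem hS)
  have hNx : ∀ x, N x = ((‖S x‖ ^ 2 : ℝ) : ℂ) := fun x => by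
    simp [hN, Complex.mul_conj, Complex.normSq_eq_norm_sq]
  set P : (Fin d → ℝ) → ℂ := ∑ i ∈ p.support, (p.coeff i : ℂ) • N ^ i with hP
  have hPm : P ∈ trigPoly d :=
    Submodule.sum_mem _ fun i _ => Submodule.smul_mem _ _ (pow_mem hNm i)
  have hPx : ∀ x, P x = ((p.eval (‖S x‖ ^ 2) : ℝ) : ℂ) := fun x => by
    rw [hP, Polynomial.eval_eq_sum, Polynomial.sum_def]
    simp [Finset.sum_apply, hNx]
  obtain ⟨m, hm⟩ := exists_mean_of_mem hPm
  refine ⟨fun x => p.eval (‖S x‖ ^ 2), p.continuous.comp (hc.norm.pow 2), ⟨m.re, ?_⟩,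
    fun x => ?_⟩
  · refine ((Complex.continuous_re.tendsto m).comp hm).congr fun T => ?_
    have : P = fun x => ((p.eval (‖S x‖ ^ 2) : ℝ) : ℂ) := funext hPx
    simp only [Function.comp, cubeAvg, this, integral_complex_ofReal, Complex.real_smul,
      Complex.re_ofReal_mul, Complex.ofReal_re, smul_eq_mul]
  · have h1 := hp (‖S x‖ ^ 2) ⟨by positivity, by gcongr; exact hC x⟩
    have h2 : (‖S x‖ ^ 2) ^ (q / 2) = ‖S x‖ ^ q := by
      rw [← Real.rpow_natCast, ← Real.rpow_mul (norm_nonneg _)]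
      congr 1
      push_cast
      ring
    simp only [h2] at h1
    rw [Real.norm_eq_abs, abs_sub_comm]
    exact h1.le

/-- The limit defining `𝓜(|S|^q)` exists. -/
lemma tendsto_norm_rpow {d : ℕ} {q : ℝ} (hq : 0 ≤ q) {S : (Fin d → ℝ) → ℂ}
    (hS : S ∈ trigPoly d) :
    Tendsto (cubeAvg fun x => ‖S x‖ ^ q) atTop (𝓝 (bohrMean fun x => ‖S x‖ ^ q)) :=
  tendsto_nhds_limUnder (exists_mean_norm_rpow hq hS)

lemma twist_mem {d : ℕ} {S : (Fin d → ℝ) → ℂ} (hS : S ∈ trigPoly d) (ξ : Fin d → ℝ) :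
    (fun x => S x * Complex.exp (-(Complex.I * ((ξ ⬝ᵥ x : ℝ) : ℂ)))) ∈ trigPoly d := by
  have h : (fun x => S x * Complex.exp (-(Complex.I * ((ξ ⬝ᵥ x : ℝ) : ℂ)))) =
      S * character (-ξ) := by
    funext x
    simp [character]
  rw [h]
  exact mul_mem hS (character_mem _)

/-- The limit defining `Ŝ(ξ)` exists. -/
lemma tendsto_polyCoeff {d : ℕ} {S : (Fin d → ℝ) → ℂ} (hS : S ∈ trigPoly d) (ξ : Fin d → ℝ) :
    Tendsto (cubeAvg fun x => S x * Complex.exp (-(Complex.I * ((ξ ⬝ᵥ x : ℝ) : ℂ)))) atTop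
      (𝓝 (polyCoeff S ξ)) :=
  tendsto_nhds_limUnder (exists_mean_of_mem (twist_mem hS ξ))

/-! ### The seminorm laws -/

lemma memLp_cube {d : ℕ} {S : (Fin d → ℝ) → ℂ} (hS : S ∈ trigPoly d) {T : ℝ} (hT : 0 < T)
    (p : ℝ≥0∞) : MemLp S p (cubeMeasure d T) := by
  have := isProbabilityMeasure_cubeMeasure (d := d) hT
  obtain ⟨C, hC⟩ := bounded_of_mem hS
  exact MemLp.of_bound (continuous_of_mem hS).aestronglyMeasurable C (Eventually.of_forall hC)

lemma cubeAvg_rpow_eq {d : ℕ} {q : ℝ} (hq : 1 ≤ q) {S : (Fin d → ℝ) → ℂ}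
    (hS : S ∈ trigPoly d) {T : ℝ} (hT : 0 < T) :
    (cubeAvg (fun x => ‖S x‖ ^ q) T) ^ (1 / q) =
      (eLpNorm S (ENNReal.ofReal q) (cubeMeasure d T)).toReal := by
  have hq0 : 0 < q := by linarith
  rw [(memLp_cube hS hT _).eLpNorm_eq_integral_rpow_norm
    (by simpa using hq0) ENNReal.ofReal_ne_top, ENNReal.toReal_ofReal hq0.le,
    cubeAvg_eq hT, ENNReal.toReal_ofReal (by positivity), one_div]

/-- `‖S‖_q` is the limit of the normalized `L^q` norms over cubes. -/
lemma tendsto_besicovitchNorm {d : ℕ} {q : ℝ} (hq : 1 ≤ q) {S : (Fin d → ℝ) → ℂ}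
    (hS : S ∈ trigPoly d) :
    Tendsto (fun T => (eLpNorm S (ENNReal.ofReal q) (cubeMeasure d T)).toReal) atTop
      (𝓝 (besicovitchNorm q S)) := by
  have hq0 : 0 < q := by linarith
  refine ((tendsto_norm_rpow hq0.le hS).rpow_const (Or.inr (by positivity))).congr' ?_
  filter_upwards [eventually_gt_atTop 0] with T hT
  exact cubeAvg_rpow_eq hq hS hT

lemma besicovitchNorm_add_le {d : ℕ} {q : ℝ} (hq : 1 ≤ q) {S R : (Fin d → ℝ) → ℂ}
    (hS : S ∈ trigPoly d) (hR : R ∈ trigPoly d) :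
    besicovitchNorm q (S + R) ≤ besicovitchNorm q S + besicovitchNorm q R := by
  refine le_of_tendsto_of_tendsto (tendsto_besicovitchNorm hq ((trigPoly d).add_mem hS hR))
    ((tendsto_besicovitchNorm hq hS).add (tendsto_besicovitchNorm hq hR)) ?_
  filter_upwards [eventually_gt_atTop 0] with T hT
  have h1 := memLp_cube hS hT (ENNReal.ofReal q)
  have h2 := memLp_cube hR hT (ENNReal.ofReal q)
  rw [← ENNReal.toReal_add h1.eLpNorm_ne_top h2.eLpNorm_ne_top]
  exact ENNReal.toReal_mono (ENNReal.add_ne_top.2 ⟨h1.eLpNorm_ne_top, h2.eLpNorm_ne_top⟩)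
    (eLpNorm_add_le h1.1 h2.1 (by simpa using ENNReal.ofReal_le_ofReal hq))

lemma besicovitchNorm_smul {d : ℕ} {q : ℝ} (hq : 1 ≤ q) (a : ℂ) {S : (Fin d → ℝ) → ℂ}
    (hS : S ∈ trigPoly d) :
    besicovitchNorm q (a • S) = ‖a‖ * besicovitchNorm q S := by
  refine tendsto_nhds_unique (tendsto_besicovitchNorm hq ((trigPoly d).smul_mem a hS))
    (((tendsto_besicovitchNorm hq hS).const_mul ‖a‖).congr fun T => ?_)
  rw [eLpNorm_const_smul, ENNReal.toReal_mul, toReal_enorm]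

lemma norm_polyCoeff_le {d : ℕ} {q : ℝ} (hq : 1 ≤ q) {S : (Fin d → ℝ) → ℂ}
    (hS : S ∈ trigPoly d) (ξ : Fin d → ℝ) :
    ‖polyCoeff S ξ‖ ≤ besicovitchNorm q S := by
  refine le_of_tendsto_of_tendsto (tendsto_polyCoeff hS ξ).norm (tendsto_besicovitchNorm hq hS) ?_
  filter_upwards [eventually_gt_atTop 0] with T hT
  have := isProbabilityMeasure_cubeMeasure (d := d) hT
  have hm := memLp_cube hS hT (ENNReal.ofReal q)
  rw [cubeAvg_eq hT]
  calc _ ≤ ∫ x, ‖S x‖ ∂(cubeMeasure d T) := by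
        refine (norm_integral_le_integral_norm _).trans (le_of_eq ?_)
        congr 1
        funext x
        rw [norm_mul, ← mul_neg, ← Complex.ofReal_neg, mul_comm Complex.I,
          Complex.norm_exp_ofReal_mul_I, mul_one]
    _ = (eLpNorm S 1 (cubeMeasure d T)).toReal := by
        rw [eLpNorm_one_eq_lintegral_enorm, integral_norm_eq_lintegral_enorm hm.1]
    _ ≤ _ := ENNReal.toReal_mono hm.eLpNorm_ne_top
        (eLpNorm_le_eLpNorm_of_exponent_le (by simpa using ENNReal.ofReal_le_ofReal hq) hm.1)

lemma polyCoeff_sub {d : ℕ} {S R : (Fin d → ℝ) → ℂ}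
    (hS : S ∈ trigPoly d) (hR : R ∈ trigPoly d) (ξ : Fin d → ℝ) :
    polyCoeff (S - R) ξ = polyCoeff S ξ - polyCoeff R ξ := by
  refine tendsto_nhds_unique (tendsto_polyCoeff ((trigPoly d).sub_mem hS hR) ξ)
    (((tendsto_polyCoeff hS ξ).sub (tendsto_polyCoeff hR ξ)).congr fun T => ?_)
  unfold cubeAvg
  rw [← smul_sub, ← integral_sub
    (integrableOn_cube (continuous_of_mem (twist_mem hS ξ)) T)
    (integrableOn_cube (continuous_of_mem (twist_mem hR ξ)) T)]
  simp only [Pi.sub_apply, sub_mul]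

/-! ### The spaces of Besicovitch almost periodic functions -/

/-- Trigonometric polynomials on `ℝᵈ`, to be equipped with the norm `‖·‖_q`. -/
def TrigPoly (d : ℕ) (_q : ℝ) : Type := trigPoly d

instance (d : ℕ) (q : ℝ) : AddCommGroup (TrigPoly d q) := inferInstanceAs (AddCommGroup (trigPoly d))

instance (d : ℕ) (q : ℝ) : Module ℂ (TrigPoly d q) := inferInstanceAs (Module ℂ (trigPoly d))

/-- The function on `ℝᵈ` underlying a trigonometric polynomial. -/
def TrigPoly.toFun {d : ℕ} {q : ℝ} (S : TrigPoly d q) : (Fin d → ℝ) → ℂ := Subtype.val S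

lemma TrigPoly.mem {d : ℕ} {q : ℝ} (S : TrigPoly d q) : S.toFun ∈ trigPoly d := Subtype.property S

instance (d : ℕ) (q : ℝ) [Fact (1 ≤ q)] : SeminormedAddCommGroup (TrigPoly d q) :=
  AddGroupSeminorm.toSeminormedAddCommGroup (Seminorm.of (𝕜 := ℂ)
    (fun S : TrigPoly d q => besicovitchNorm q S.toFun)
    (fun S R => besicovitchNorm_add_le Fact.out S.mem R.mem)
    (fun a S => besicovitchNorm_smul Fact.out a S.mem)).toAddGroupSeminorm

lemma norm_trigPoly {d : ℕ} {q : ℝ} [Fact (1 ≤ q)] (S : TrigPoly d q) :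
    ‖S‖ = besicovitchNorm q S.toFun := rfl

/-- The space `B^q_ap(ℝᵈ)`: the completion of the trigonometric polynomials for `‖·‖_q`. -/
abbrev Besicovitch (d : ℕ) (q : ℝ) [Fact (1 ≤ q)] : Type :=
  UniformSpace.Completion (TrigPoly d q)

/-- The Fourier coefficient `f̂(ξ) = lim Ŝₙ(ξ)` of `f ∈ B^q_ap(ℝᵈ)`, where `Sₙ → f` are trigonometric
polynomials: the continuous extension of `S ↦ Ŝ(ξ)` to the completion. -/
def fourierCoeff {d : ℕ} {q : ℝ} [Fact (1 ≤ q)] (f : Besicovitch d q) (ξ : Fin d → ℝ) : ℂ :=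
  UniformSpace.Completion.extension (fun S : TrigPoly d q => polyCoeff S.toFun ξ) f

/-- The extension defining `fourierCoeff` is the genuine one. -/
lemma uniformContinuous_polyCoeff {d : ℕ} {q : ℝ} [Fact (1 ≤ q)] (ξ : Fin d → ℝ) :
    UniformContinuous (fun S : TrigPoly d q => polyCoeff S.toFun ξ) := by
  refine (LipschitzWith.of_dist_le_mul (K := 1) fun S R => ?_).uniformContinuous
  rw [dist_eq_norm, dist_eq_norm, ← polyCoeff_sub S.mem R.mem, NNReal.coe_one, one_mul,
    norm_trigPoly]
  exact norm_polyCoeff_le Fact.out ((trigPoly d).sub_mem S.mem R.mem) ξ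

lemma fourierCoeff_coe {d : ℕ} {q : ℝ} [Fact (1 ≤ q)] (S : TrigPoly d q) (ξ : Fin d → ℝ) :
    fourierCoeff (S : Besicovitch d q) ξ = polyCoeff S.toFun ξ :=
  UniformSpace.Completion.extension_coe (uniformContinuous_polyCoeff ξ) S

/-- The Fourier coefficients of `f` are the limits of those of any sequence of polynomials
tending to `f`. -/
lemma tendsto_fourierCoeff {d : ℕ} {q : ℝ} [Fact (1 ≤ q)] {f : Besicovitch d q}
    {S : ℕ → TrigPoly d q} (hS : Tendsto (fun n => (S n : Besicovitch d q)) atTop (𝓝 f))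
    (ξ : Fin d → ℝ) :
    Tendsto (fun n => polyCoeff (S n).toFun ξ) atTop (𝓝 (fourierCoeff f ξ)) := by
  have h : Continuous fun g : Besicovitch d q => fourierCoeff g ξ :=
    UniformSpace.Completion.continuous_extension
  exact ((h.tendsto f).comp hS).congr fun n => fourierCoeff_coe (S n) ξ

/-- The Bohr spectrum `σ_f = {ξ : f̂(ξ) ≠ 0}`. -/
def spectrum {d : ℕ} {q : ℝ} [Fact (1 ≤ q)] (f : Besicovitch d q) : Set (Fin d → ℝ) :=
  {ξ | fourierCoeff f ξ ≠ 0}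

/-- The `ℓ^p` norm `(∑ |a_i|^p)^{1/p}`, which is `sup |a_i|` for `p = ∞`, with values in `[0, ∞]`. -/
def ellNorm {ι : Type*} (p : ℝ≥0∞) (a : ι → ℂ) : ℝ≥0∞ :=
  if p = ∞ then ⨆ i, ‖a i‖ₑ else (∑' i, ‖a i‖ₑ ^ p.toReal) ^ (1 / p.toReal)

end BesicovitchAP

end

namespace BesicovitchAP

/-! Part (a) is the Hausdorff-Young inequality for the characters, which are orthonormal only in the
limit of large cubes. On the cube `[-T,T]ᵈ` finitely many of them satisfy a Bessel inequality with a
constant tending to 1 (`integral_norm_sq_sum_le`, `tendsto_cubeBessel`). On any probability space,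
such a Bessel inequality, together with the trivial bound of a coefficient by the `L¹` norm, gives
by the three-lines theorem the estimate of `∑ b_i ∫ S φ_i` by the `L^q` norm of `S` and the `ℓ^q`
norm of `b` (`norm_sum_mul_integral_le`). Letting `T → ∞` removes the constant. The dual form with
finitely many frequencies and fixed `b` is continuous in `S`, so it extends to the completion;
testing with the extremal `b` then gives the `ℓ^{q'}` bound (`sum_rpow_le_of_pairing_le`).

Part (b) follows from (a) at the conjugate exponent `p = q' ≤ 2` by duality. The norm of a
polynomial `S` is controlled by the means `𝓜(S P)` over polynomials `P`
(`besicovitchNorm_le_of_dual`). Such a mean is a finite pairing of coefficients. If `S` is close to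
`f`, replacing `Ŝ` by `f̂` costs at most `‖S - f‖_q ‖P‖_p` (`norm_pairing_sub_le`), and what remains
is bounded by Hölder and by (a) applied to `P` (`norm_pairing_le_ellNorm`). No convergence question
arises, since `P` has finitely many frequencies. -/

/-- The entire family `z ↦ w |w|^{q(1 - z/2) - 1}`, which equals `w` at `z = 2 - 2/q` and has absolute
value `|w|^{q(1 - Re z / 2)}`. -/
noncomputable def interpFamily (q : ℝ) (w z : ℂ) : ℂ :=
  w * Complex.exp ((Real.log ‖w‖ : ℂ) * (q * (1 - z / 2) - 1))

lemma hasDerivAt_interpFamily (q : ℝ) (w z : ℂ) :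
    HasDerivAt (interpFamily q w) (interpFamily q w z * (Real.log ‖w‖ * (-(q / 2)))) z := by
  have h : HasDerivAt (fun z : ℂ => (Real.log ‖w‖ : ℂ) * (q * (1 - z / 2) - 1))
      (Real.log ‖w‖ * (q * (-(1 / 2)))) z :=
    ((((((hasDerivAt_id z).div_const 2).const_sub 1).const_mul (q : ℂ)).sub_const 1).const_mul _)
  refine (h.cexp.const_mul w).congr_deriv ?_
  unfold interpFamily
  ring

lemma measurable_interpFamily (q : ℝ) (z : ℂ) : Measurable fun w => interpFamily q w z := by
  unfold interpFamily
  fun_prop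

lemma norm_interpFamily {q : ℝ} (hq : 0 < q) (w : ℂ) {z : ℂ} (hz : z.re < 2) :
    ‖interpFamily q w z‖ = ‖w‖ ^ (q * (1 - z.re / 2)) := by
  unfold interpFamily
  rw [norm_mul, Complex.norm_exp]
  have h : ((Real.log ‖w‖ : ℂ) * (q * (1 - z / 2) - 1)).re =
      Real.log ‖w‖ * (q * (1 - z.re / 2) - 1) := by
    rw [Complex.re_ofReal_mul]
    simp
  rw [h]
  -- At `w = 0` the factor `w` makes the left side 0; the right side is 0 because `Re z < 2` keeps
  -- the exponent positive.
  rcases eq_or_ne w 0 with rfl | hw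
  · have : q * (1 - z.re / 2) ≠ 0 := by
      have : 0 < 1 - z.re / 2 := by linarith
      positivity
    simp [Real.zero_rpow this]
  · have hw' : 0 < ‖w‖ := norm_pos_iff.2 hw
    rw [← Real.rpow_def_of_pos hw', Real.rpow_sub_one hw'.ne']
    field_simp

lemma interpFamily_at {q : ℝ} (hq : 0 < q) (w : ℂ) :
    interpFamily q w ((2 - 2 / q : ℝ) : ℂ) = w := by
  unfold interpFamily
  have : (q : ℂ) ≠ 0 := by exact_mod_cast hq.ne'
  have h : (q : ℂ) * (1 - ((2 - 2 / q : ℝ) : ℂ) / 2) - 1 = 0 := by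
    push_cast
    field_simp
    ring
  rw [h]
  simp

/-- The exponent of `‖w‖` lies in `(0, 2q)` on this strip. The strip is wider than `0 ≤ Re z ≤ 1` to
leave room for Cauchy circles. -/
lemma norm_interpFamily_le {q : ℝ} (hq : 0 < q) {C : ℝ} (hC : 1 ≤ C) {w : ℂ} (hw : ‖w‖ ≤ C) {z : ℂ}
    (hz : z.re < 2) (hz' : -2 < z.re) : ‖interpFamily q w z‖ ≤ C ^ (2 * q) := by
  rw [norm_interpFamily hq w hz]
  calc ‖w‖ ^ (q * (1 - z.re / 2)) ≤ C ^ (q * (1 - z.re / 2)) :=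
        Real.rpow_le_rpow (norm_nonneg _) hw (mul_nonneg hq.le (by linarith))
    _ ≤ C ^ (2 * q) := Real.rpow_le_rpow_of_exponent_le hC (by nlinarith)

/-! ### Three-lines interpolation on a probability space -/

section

variable {Ω : Type*} [MeasurableSpace Ω] {μ : Measure Ω} [IsProbabilityMeasure μ]

/-- Differentiation under the integral sign. The derivative contains `log ‖S x‖`, unbounded near
zeros of `S`; Cauchy's estimate on circles of radius `1/4` bounds it uniformly from the bound on the
family alone. -/
lemma differentiableAt_integral_interpFamily {q : ℝ} (hq : 0 < q) {S φ : Ω → ℂ} (hS : Measurable S)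
    (hφ : Measurable φ) {C : ℝ} (hC : 1 ≤ C) (hSC : ∀ x, ‖S x‖ ≤ C) (hφ1 : ∀ x, ‖φ x‖ ≤ 1)
    {z : ℂ} (h0 : 0 ≤ z.re) (h1 : z.re ≤ 1) :
    DifferentiableAt ℂ (fun z => ∫ x, interpFamily q (S x) z * φ x ∂μ) z := by
  have hm : ∀ z, Measurable fun x => interpFamily q (S x) z * φ x := fun z =>
    ((measurable_interpFamily q z).comp hS).mul hφ
  have hre : ∀ y ∈ Metric.ball z (1 / 4 : ℝ), ∀ v ∈ Metric.sphere y (1 / 4 : ℝ),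
      v.re < 2 ∧ -2 < v.re := by
    intro y hy v hv
    rw [Metric.mem_ball, dist_eq_norm] at hy
    rw [mem_sphere_iff_norm] at hv
    have a1 := abs_le.1 ((Complex.abs_re_le_norm (y - z)).trans hy.le)
    have a2 := abs_le.1 ((Complex.abs_re_le_norm (v - y)).trans hv.le)
    simp only [Complex.sub_re] at a1 a2
    constructor <;> linarith [a1.1, a1.2, a2.1, a2.2]
  refine (hasDerivAt_integral_of_dominated_loc_of_deriv_le
    (F' := fun z x => interpFamily q (S x) z * (Real.log ‖S x‖ * (-(q / 2))) * φ x)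
    (bound := fun _ => C ^ (2 * q) / (1 / 4))
    (Metric.ball_mem_nhds z (by norm_num : (0 : ℝ) < 1 / 4))
    (Eventually.of_forall fun z => (hm z).aestronglyMeasurable) ?_ ?_ ?_ (integrable_const _) ?_
    ).2.differentiableAt
  · refine Integrable.of_bound (hm z).aestronglyMeasurable (C ^ (2 * q)) (ae_of_all _ fun x => ?_)
    rw [norm_mul]
    exact (mul_le_of_le_one_right (norm_nonneg _) (hφ1 x)).trans
      (norm_interpFamily_le hq hC (hSC x) (by linarith) (by linarith))
  · have := (measurable_interpFamily q z).comp hS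
    refine Measurable.aestronglyMeasurable (Measurable.mul (Measurable.mul this ?_) hφ)
    fun_prop
  · refine ae_of_all _ fun x y hy => ?_
    rw [norm_mul, ← (hasDerivAt_interpFamily q (S x) y).deriv]
    refine (mul_le_of_le_one_right (norm_nonneg _) (hφ1 x)).trans ?_
    refine Complex.norm_deriv_le_of_forall_mem_sphere_norm_le (by norm_num) ?_ fun v hv => ?_
    · exact Differentiable.diffContOnCl
        fun v => (hasDerivAt_interpFamily q (S x) v).differentiableAt
    · exact norm_interpFamily_le hq hC (hSC x) (hre y hy v hv).1 (hre y hy v hv).2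
  · exact ae_of_all _ fun x y _ => (hasDerivAt_interpFamily q (S x) y).mul_const _

/-- The Hausdorff-Young inequality, in dual form, for a bounded function and a finite family of
functions bounded by one with Bessel constant `K`. -/
lemma norm_sum_mul_integral_le {q : ℝ} (hq1 : 1 ≤ q) (hq2 : q ≤ 2) {ι : Type*} (s : Finset ι)
    {S : Ω → ℂ} {φ : ι → Ω → ℂ} (hS : Measurable S) (hφ : ∀ i, Measurable (φ i))
    (hSb : ∃ C, ∀ x, ‖S x‖ ≤ C) (hφ1 : ∀ i x, ‖φ i x‖ ≤ 1) {K : ℝ} (hK1 : 1 ≤ K)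
    (hK : ∀ c : ι → ℂ, ∫ x, ‖∑ i ∈ s, c i * φ i x‖ ^ 2 ∂μ ≤ K * ∑ i ∈ s, ‖c i‖ ^ 2) (b : ι → ℂ) :
    ‖∑ i ∈ s, b i * ∫ x, S x * φ i x ∂μ‖ ≤
      K * ((∫ x, ‖S x‖ ^ q ∂μ) ^ (1 / q) * (∑ i ∈ s, ‖b i‖ ^ q) ^ (1 / q)) := by
  have hq : 0 < q := by linarith
  obtain ⟨C, hC, hSC⟩ : ∃ C, 1 ≤ C ∧ ∀ x, ‖S x‖ ≤ C := by
    obtain ⟨C, hC⟩ := hSb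
    exact ⟨max 1 C, le_max_left _ _, fun x => (hC x).trans (le_max_right _ _)⟩
  set A := ∫ x, ‖S x‖ ^ q ∂μ with hA
  set B := ∑ i ∈ s, ‖b i‖ ^ q with hB
  have hA0 : 0 ≤ A := integral_nonneg fun x => by positivity
  have hB0 : 0 ≤ B := Finset.sum_nonneg fun i _ => by positivity
  have hmP : ∀ z, Measurable fun x => interpFamily q (S x) z := fun z =>
    (measurable_interpFamily q z).comp hS
  have hint : ∀ z : ℂ, 0 ≤ z.re → z.re ≤ 1 → ∀ i,
      Integrable (fun x => interpFamily q (S x) z * φ i x) μ := by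
    intro z h0 h1 i
    refine Integrable.of_bound ((hmP z).mul (hφ i)).aestronglyMeasurable (C ^ (2 * q))
      (ae_of_all _ fun x => ?_)
    rw [norm_mul]
    exact (mul_le_of_le_one_right (norm_nonneg _) (hφ1 i x)).trans
      (norm_interpFamily_le hq hC (hSC x) (by linarith) (by linarith))
  have hbd : ∀ z : ℂ, 0 ≤ z.re → z.re ≤ 1 → ∀ i,
      ‖∫ x, interpFamily q (S x) z * φ i x ∂μ‖ ≤ ∫ x, ‖interpFamily q (S x) z‖ ∂μ := by
    intro z h0 h1 i
    refine norm_integral_le_of_norm_le ?_ (ae_of_all _ fun x => ?_)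
    · refine Integrable.of_bound (hmP z).norm.aestronglyMeasurable (C ^ (2 * q))
        (ae_of_all _ fun x => ?_)
      rw [norm_norm]
      exact norm_interpFamily_le hq hC (hSC x) (by linarith) (by linarith)
    · rw [norm_mul]
      exact mul_le_of_le_one_right (norm_nonneg _) (hφ1 i x)
  -- Both `b` and `S` are deformed analytically; at `z = 2 - 2/q` they return to themselves, so `F`
  -- is the sum to be bounded.
  set F : ℂ → ℂ := fun z => ∑ i ∈ s, interpFamily q (b i) z *
    ∫ x, interpFamily q (S x) z * φ i x ∂μ with hF
  have hdiff : ∀ z : ℂ, 0 ≤ z.re → z.re ≤ 1 → DifferentiableAt ℂ F z := by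
    intro z h0 h1
    refine DifferentiableAt.fun_sum fun i _ => ?_
    exact (hasDerivAt_interpFamily q (b i) z).differentiableAt.mul
      (differentiableAt_integral_interpFamily hq hS (hφ i) hC hSC (hφ1 i) h0 h1)
  have hcl : closure (Complex.HadamardThreeLines.verticalStrip 0 1) =
      Complex.HadamardThreeLines.verticalClosedStrip 0 1 := by
    rw [Complex.HadamardThreeLines.verticalStrip, Complex.HadamardThreeLines.verticalClosedStrip,
      ← closure_Ioo zero_ne_one, Complex.closure_preimage_re]
  have hdc : DiffContOnCl ℂ F (Complex.HadamardThreeLines.verticalStrip 0 1) := by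
    refine ⟨fun z hz => (hdiff z hz.1.le hz.2.le).differentiableWithinAt, fun z hz => ?_⟩
    rw [hcl] at hz
    exact (hdiff z hz.1 hz.2).continuousAt.continuousWithinAt
  have hbdd : BddAbove ((norm ∘ F) '' Complex.HadamardThreeLines.verticalClosedStrip 0 1) := by
    obtain ⟨D, hD1, hD⟩ : ∃ D : ℝ, 1 ≤ D ∧ ∀ i ∈ s, ‖b i‖ ≤ D :=
      ⟨1 + ∑ i ∈ s, ‖b i‖, by simp [Finset.sum_nonneg], fun i hi => by
        have := Finset.single_le_sum (f := fun i => ‖b i‖) (fun i _ => norm_nonneg _) hi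
        linarith⟩
    refine ⟨∑ i ∈ s, D ^ (2 * q) * C ^ (2 * q), ?_⟩
    rintro _ ⟨z, hz, rfl⟩
    have h0 : 0 ≤ z.re := hz.1
    have h1 : z.re ≤ 1 := hz.2
    refine norm_sum_le_of_le _ fun i hi => ?_
    rw [norm_mul]
    refine mul_le_mul (norm_interpFamily_le hq hD1 (hD i hi) (by linarith) (by linarith))
      ((norm_integral_le_of_norm_le_const (C := C ^ (2 * q)) (ae_of_all _ fun x => ?_)).trans_eq
        (by simp))
      (norm_nonneg _) (by positivity)
    · rw [norm_mul]
      exact (mul_le_of_le_one_right (norm_nonneg _) (hφ1 i x)).trans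
        (norm_interpFamily_le hq hC (hSC x) (by linarith) (by linarith))
  -- The `L¹`-`ℓ¹` endpoint: the deformed moduli are `‖S‖^q` and `‖b i‖^q`.
  have hleft : ∀ z ∈ Complex.re ⁻¹' {0}, ‖F z‖ ≤ A * B := by
    intro z hz
    have hz : z.re = 0 := hz
    rw [hB, Finset.mul_sum]
    refine norm_sum_le_of_le _ fun i _ => ?_
    rw [norm_mul, norm_interpFamily hq _ (by linarith), hz, mul_comm]
    have := hbd z hz.ge (by linarith) i
    simp only [norm_interpFamily hq _ (show z.re < 2 by linarith), hz] at this
    simp only [zero_div, sub_zero, mul_one] at this ⊢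
    gcongr
  -- The `L²`-`ℓ²` endpoint: the deformed moduli are `‖S‖^{q/2}` and `‖b i‖^{q/2}`, so
  -- Cauchy-Schwarz and the Bessel bound apply.
  have hright : ∀ z ∈ Complex.re ⁻¹' {1}, ‖F z‖ ≤ (A * (K * B)) ^ (1 / 2 : ℝ) := by
    intro z hz
    have hz : z.re = 1 := hz
    have hn : ∀ w, ‖interpFamily q w z‖ ^ 2 = ‖w‖ ^ q := fun w => by
      rw [norm_interpFamily hq _ (by linarith), hz, ← Real.rpow_natCast,
        ← Real.rpow_mul (norm_nonneg _)]
      congr 1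
      push_cast
      ring
    have hFz : F z = ∫ x, interpFamily q (S x) z * ∑ i ∈ s, interpFamily q (b i) z * φ i x ∂μ := by
      simp only [hF, Finset.mul_sum]
      rw [integral_finsetSum]
      · refine Finset.sum_congr rfl fun i _ => ?_
        rw [← integral_const_mul]
        congr 1
        funext x
        ring
      · intro i _
        refine ((hint z (by linarith) hz.le i).const_mul (interpFamily q (b i) z)).congr
          (ae_of_all _ fun x => ?_)
        simp only
        ring
    have hm2 : Measurable fun x => ∑ i ∈ s, interpFamily q (b i) z * φ i x :=
      Finset.measurable_fun_sum _ fun i _ => (hφ i).const_mul _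
    have hL1 : MemLp (fun x => ‖interpFamily q (S x) z‖) (ENNReal.ofReal 2) μ :=
      MemLp.of_bound (hmP z).norm.aestronglyMeasurable (C ^ (2 * q)) (ae_of_all _ fun x => by
        rw [norm_norm]
        exact norm_interpFamily_le hq hC (hSC x) (by linarith) (by linarith))
    have hL2 : MemLp (fun x => ‖∑ i ∈ s, interpFamily q (b i) z * φ i x‖) (ENNReal.ofReal 2) μ :=
      MemLp.of_bound hm2.norm.aestronglyMeasurable (∑ i ∈ s, ‖interpFamily q (b i) z‖)
        (ae_of_all _ fun x => by
          rw [norm_norm]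
          refine norm_sum_le_of_le _ fun i _ => ?_
          rw [norm_mul]
          exact mul_le_of_le_one_right (norm_nonneg _) (hφ1 i x))
    have hCS := integral_mul_le_Lp_mul_Lq_of_nonneg (μ := μ) Real.HolderConjugate.two_two
      (ae_of_all _ fun x => norm_nonneg (interpFamily q (S x) z))
      (ae_of_all _ fun x => norm_nonneg (∑ i ∈ s, interpFamily q (b i) z * φ i x)) hL1 hL2
    have hKz := hK fun i => interpFamily q (b i) z
    simp only [Real.rpow_two, hn] at hCS hKz
    rw [hFz]
    refine (norm_integral_le_integral_norm _).trans ?_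
    simp only [norm_mul]
    refine hCS.trans ?_
    rw [Real.mul_rpow hA0 (by positivity)]
    gcongr
  have hθ0 : 0 ≤ 2 - 2 / q := by
    rw [sub_nonneg, div_le_iff₀ hq]
    linarith
  have hθ1 : 2 - 2 / q ≤ 1 := by
    have : 1 ≤ 2 / q := by rwa [le_div_iff₀ hq, one_mul]
    linarith
  have key := Complex.HadamardThreeLines.norm_le_interp_of_mem_verticalClosedStrip₀₁' F
    (z := ((2 - 2 / q : ℝ) : ℂ)) (by
      simpa only [Complex.HadamardThreeLines.verticalClosedStrip, Set.mem_preimage,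
        Complex.ofReal_re] using ⟨hθ0, hθ1⟩) hdc hbdd hleft hright
  simp only [hF, interpFamily_at hq, Complex.ofReal_re] at key
  refine key.trans ?_
  -- With `θ = 2 - 2/q`, the power of `A * B` is `(1 - θ) + θ/2 = 1/q`. The factor `K^{θ/2}` is
  -- relaxed to `K`, which is harmless as `K` will tend to 1.
  have hAB : 0 ≤ A * B := mul_nonneg hA0 hB0
  rw [show A * (K * B) = K * (A * B) by ring, ← Real.rpow_mul (by positivity),
    Real.mul_rpow (by linarith) hAB, mul_left_comm, ← Real.mul_rpow hA0 hB0,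
    ← Real.rpow_add_of_nonneg hAB (by linarith) (by positivity)]
  refine mul_le_mul ?_ (le_of_eq ?_) (by positivity) (by linarith)
  · calc K ^ (1 / 2 * (2 - 2 / q)) ≤ K ^ (1 : ℝ) :=
          Real.rpow_le_rpow_of_exponent_le hK1 (by linarith)
      _ = K := Real.rpow_one K
  · congr 1
    field_simp
    ring

end

/-! ### Linearity of the mean and Fourier expansions of polynomials -/

lemma tendsto_bohrMean {d : ℕ} {S : (Fin d → ℝ) → ℂ} (hS : S ∈ trigPoly d) :
    Tendsto (cubeAvg S) atTop (𝓝 (bohrMean S)) :=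
  tendsto_nhds_limUnder (exists_mean_of_mem hS)

lemma bohrMean_add {d : ℕ} {S R : (Fin d → ℝ) → ℂ} (hS : S ∈ trigPoly d) (hR : R ∈ trigPoly d) :
    bohrMean (S + R) = bohrMean S + bohrMean R :=
  tendsto_nhds_unique (tendsto_bohrMean ((trigPoly d).add_mem hS hR))
    (((tendsto_bohrMean hS).add (tendsto_bohrMean hR)).congr fun T =>
      (cubeAvg_add (continuous_of_mem hS) (continuous_of_mem hR) T).symm)

lemma bohrMean_smul {d : ℕ} (a : ℂ) {S : (Fin d → ℝ) → ℂ} (hS : S ∈ trigPoly d) :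
    bohrMean (a • S) = a * bohrMean S :=
  tendsto_nhds_unique (tendsto_bohrMean ((trigPoly d).smul_mem a hS))
    (((tendsto_bohrMean hS).const_smul a).congr fun T => (cubeAvg_smul a S T).symm)

lemma bohrMean_sum {d : ℕ} {ι : Type*} (s : Finset ι) {S : ι → (Fin d → ℝ) → ℂ}
    (hS : ∀ i, S i ∈ trigPoly d) : bohrMean (∑ i ∈ s, S i) = ∑ i ∈ s, bohrMean (S i) := by
  classical
  induction s using Finset.induction_on with
  | empty =>
    rw [Finset.sum_empty, Finset.sum_empty]
    simpa using bohrMean_smul 0 (one_mem (d := d))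
  | insert i s hi ih =>
    rw [Finset.sum_insert hi, Finset.sum_insert hi,
      bohrMean_add (hS i) (Submodule.sum_mem _ fun j _ => hS j), ih]

lemma bohrMean_character {d : ℕ} (ξ : Fin d → ℝ) :
    bohrMean (character ξ) = if ξ = 0 then 1 else 0 :=
  (tendsto_cubeAvg_character ξ).limUnder_eq

lemma polyCoeff_eq_bohrMean {d : ℕ} (S : (Fin d → ℝ) → ℂ) (ξ : Fin d → ℝ) :
    polyCoeff S ξ = bohrMean (S * character (-ξ)) := by
  unfold polyCoeff
  congr 1
  funext x
  simp [character]

/-- By orthogonality, twisting `P` by `character (-η)` and averaging leaves only the term of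
frequency `η`. Having the Fourier coefficients themselves in the expansion is what lets
Hausdorff-Young be applied to `P` in the duality argument. -/
lemma exists_fourier_expansion {d : ℕ} {P : (Fin d → ℝ) → ℂ} (hP : P ∈ trigPoly d) :
    ∃ s : Finset (Fin d → ℝ), P = ∑ ξ ∈ s, polyCoeff P ξ • character ξ := by
  obtain ⟨c, hc⟩ := (Finsupp.mem_span_range_iff_exists_finsupp).1 hP
  refine ⟨c.support, ?_⟩
  have hcoeff : ∀ η ∈ c.support, polyCoeff P η = c η := by
    intro η hη
    have h1 : P * character (-η) = ∑ ξ ∈ c.support, c ξ • character (ξ - η) := by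
      rw [← hc, Finsupp.sum, Finset.sum_mul]
      refine Finset.sum_congr rfl fun ξ _ => ?_
      rw [smul_mul_assoc, character_mul, sub_eq_add_neg]
    rw [polyCoeff_eq_bohrMean, h1,
      bohrMean_sum _ fun ξ => (trigPoly d).smul_mem _ (character_mem _)]
    simp only [bohrMean_smul _ (character_mem _), bohrMean_character, sub_eq_zero]
    simpa using fun h => h.symm
  rw [Finset.sum_congr rfl fun ξ hξ => by rw [hcoeff ξ hξ]]
  exact hc.symm

/-- Parseval for a bilinear pairing: with no conjugate on `P`, the frequency `ξ` of `P` meets `-ξ`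
of `S`. -/
lemma bohrMean_mul_eq_sum {d : ℕ} {S P : (Fin d → ℝ) → ℂ} (hS : S ∈ trigPoly d)
    {s : Finset (Fin d → ℝ)} {c : (Fin d → ℝ) → ℂ} (hP : P = ∑ ξ ∈ s, c ξ • character ξ) :
    bohrMean (S * P) = ∑ ξ ∈ s, c ξ * polyCoeff S (-ξ) := by
  have h1 : S * P = ∑ ξ ∈ s, c ξ • (S * character ξ) := by
    rw [hP, Finset.mul_sum]
    simp only [mul_smul_comm]
  rw [h1, bohrMean_sum _ fun ξ => (trigPoly d).smul_mem _ (mul_mem hS (character_mem _))]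
  refine Finset.sum_congr rfl fun ξ _ => ?_
  rw [bohrMean_smul _ (mul_mem hS (character_mem _)), polyCoeff_eq_bohrMean, neg_neg]

/-! ### The Hausdorff-Young inequality -/

/-- A Bessel constant for the characters with frequencies in `-s` on the cube `[-T,T]ᵈ`. -/
noncomputable def cubeBessel {d : ℕ} (s : Finset (Fin d → ℝ)) (T : ℝ) : ℝ :=
  1 + ∑ ξ ∈ s, ∑ η ∈ s, ‖cubeAvg (character (η - ξ)) T - if ξ = η then 1 else 0‖

lemma one_le_cubeBessel {d : ℕ} (s : Finset (Fin d → ℝ)) (T : ℝ) : 1 ≤ cubeBessel s T :=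
  le_add_of_nonneg_right
    (Finset.sum_nonneg fun _ _ => Finset.sum_nonneg fun _ _ => norm_nonneg _)

lemma tendsto_cubeBessel {d : ℕ} (s : Finset (Fin d → ℝ)) :
    Tendsto (cubeBessel s) atTop (𝓝 1) := by
  have h : Tendsto (cubeBessel s) atTop (𝓝 (1 + ∑ ξ ∈ s, ∑ η ∈ s, 0)) := by
    refine (tendsto_finsetSum _ fun ξ _ => tendsto_finsetSum _ fun η _ => ?_).const_add 1
    have := ((tendsto_cubeAvg_character (η - ξ)).sub_const (if ξ = η then (1 : ℂ) else 0)).norm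
    simpa only [sub_eq_zero, eq_comm (a := η), sub_self, norm_zero] using this
  simpa using h

/-- Expanding the square gives the quadratic form of the Gram matrix of the characters; its
deviation from the identity is estimated entry by entry. -/
lemma integral_norm_sq_sum_le {d : ℕ} (s : Finset (Fin d → ℝ)) {T : ℝ} (hT : 0 < T)
    (c : (Fin d → ℝ) → ℂ) :
    ∫ x, ‖∑ ξ ∈ s, c ξ * character (-ξ) x‖ ^ 2 ∂(cubeMeasure d T) ≤
      cubeBessel s T * ∑ ξ ∈ s, ‖c ξ‖ ^ 2 := by
  set N := ∑ ξ ∈ s, ‖c ξ‖ ^ 2 with hN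
  set G : (Fin d → ℝ) → (Fin d → ℝ) → ℂ := fun ξ η => cubeAvg (character (η - ξ)) T with hG
  have hpt : ∀ x, ((‖∑ ξ ∈ s, c ξ * character (-ξ) x‖ ^ 2 : ℝ) : ℂ) =
      ∑ ξ ∈ s, ∑ η ∈ s, c ξ * (starRingEnd ℂ) (c η) * character (η - ξ) x := by
    intro x
    rw [Complex.ofReal_pow, ← Complex.mul_conj', map_sum, Finset.sum_mul_sum]
    refine Finset.sum_congr rfl fun ξ _ => Finset.sum_congr rfl fun η _ => ?_
    have h1 : (starRingEnd ℂ) (character (-η) x) = character η x := by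
      simpa using congrFun (conj_character (-η)) x
    have h2 := congrFun (character_mul η (-ξ)) x
    rw [sub_eq_add_neg, ← h2, map_mul, h1, Pi.mul_apply]
    ring
  have hcast : ((∫ x, ‖∑ ξ ∈ s, c ξ * character (-ξ) x‖ ^ 2 ∂(cubeMeasure d T) : ℝ) : ℂ) =
      ∑ ξ ∈ s, ∑ η ∈ s, c ξ * (starRingEnd ℂ) (c η) * G ξ η := by
    rw [← integral_complex_ofReal]
    simp only [hpt]
    have hi : ∀ ξ η, Integrable (fun x => c ξ * (starRingEnd ℂ) (c η) * character (η - ξ) x)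
        (cubeMeasure d T) := fun ξ η => (integrable_cube (continuous_character _) T).const_mul _
    rw [integral_finsetSum _ fun ξ _ => integrable_finsetSum _ fun η _ => hi ξ η]
    refine Finset.sum_congr rfl fun ξ _ => ?_
    rw [integral_finsetSum _ fun η _ => hi ξ η]
    refine Finset.sum_congr rfl fun η _ => ?_
    rw [integral_const_mul, ← cubeAvg_eq hT]
  have hsplit : ∑ ξ ∈ s, ∑ η ∈ s, c ξ * (starRingEnd ℂ) (c η) * G ξ η =
      (N : ℂ) + ∑ ξ ∈ s, ∑ η ∈ s,
        c ξ * (starRingEnd ℂ) (c η) * (G ξ η - if ξ = η then 1 else 0) := by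
    simp only [mul_sub, Finset.sum_sub_distrib, mul_ite, mul_one, mul_zero, Finset.sum_ite_eq]
    rw [Finset.sum_congr rfl fun ξ (hξ : ξ ∈ s) => if_pos hξ]
    simp [hN, Complex.mul_conj']
  have hc : ∀ ξ ∈ s, ‖c ξ‖ ^ 2 ≤ N := fun ξ hξ =>
    Finset.single_le_sum (f := fun ξ => ‖c ξ‖ ^ 2) (fun _ _ => by positivity) hξ
  have hN0 : 0 ≤ N := Finset.sum_nonneg fun _ _ => by positivity
  have hnn : 0 ≤ ∫ x, ‖∑ ξ ∈ s, c ξ * character (-ξ) x‖ ^ 2 ∂(cubeMeasure d T) :=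
    integral_nonneg fun x => by positivity
  rw [← abs_of_nonneg hnn, ← Real.norm_eq_abs, ← Complex.norm_real, hcast, hsplit]
  refine (norm_add_le _ _).trans ?_
  rw [Complex.norm_real, Real.norm_of_nonneg hN0, cubeBessel, add_mul, one_mul, Finset.sum_mul]
  gcongr
  refine norm_sum_le_of_le _ fun ξ hξ => ?_
  rw [Finset.sum_mul]
  refine norm_sum_le_of_le _ fun η hη => ?_
  rw [norm_mul, norm_mul, RCLike.norm_conj, mul_comm]
  gcongr
  -- `‖c ξ‖ ‖c η‖ ≤ (‖c ξ‖² + ‖c η‖²) / 2 ≤ N`, which also covers `ξ = η`.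
  nlinarith [hc ξ hξ, hc η hη, sq_nonneg (‖c ξ‖ - ‖c η‖)]

/-- The interpolation bound holds on every cube, and its Bessel constant disappears as `T → ∞`. -/
lemma norm_sum_mul_polyCoeff_le {d : ℕ} {q : ℝ} (hq1 : 1 ≤ q) (hq2 : q ≤ 2)
    {S : (Fin d → ℝ) → ℂ} (hS : S ∈ trigPoly d) (s : Finset (Fin d → ℝ)) (b : (Fin d → ℝ) → ℂ) :
    ‖∑ ξ ∈ s, b ξ * polyCoeff S ξ‖ ≤
      besicovitchNorm q S * (∑ ξ ∈ s, ‖b ξ‖ ^ q) ^ (1 / q) := by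
  have hlim := (tendsto_cubeBessel s).mul
    (((tendsto_norm_rpow (zero_le_one.trans hq1) hS).rpow_const
      (p := 1 / q) (Or.inr (by positivity))).mul_const ((∑ ξ ∈ s, ‖b ξ‖ ^ q) ^ (1 / q)))
  rw [one_mul] at hlim
  refine le_of_tendsto_of_tendsto (tendsto_finsetSum s fun ξ _ =>
    ((tendsto_bohrMean (mul_mem hS (character_mem (-ξ)))).const_mul (b ξ))).norm hlim ?_
    |>.trans_eq' ?_
  · filter_upwards [eventually_gt_atTop 0] with T hT
    have := isProbabilityMeasure_cubeMeasure (d := d) hT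
    simp only [cubeAvg_eq hT, Pi.mul_apply]
    exact norm_sum_mul_integral_le hq1 hq2 s (continuous_of_mem hS).measurable
      (fun ξ => (continuous_character (-ξ)).measurable) (bounded_of_mem hS)
      (fun ξ x => (norm_character (-ξ) x).le) (one_le_cubeBessel s T)
      (integral_norm_sq_sum_le s hT) b
  · simp only [polyCoeff_eq_bohrMean]

lemma continuous_fourierCoeff {d : ℕ} {q : ℝ} [Fact (1 ≤ q)] (ξ : Fin d → ℝ) :
    Continuous fun f : Besicovitch d q => fourierCoeff f ξ :=
  UniformSpace.Completion.continuous_extension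

/-- This gives the endpoint `q = 1` of part (a), where `q' = ∞`. -/
lemma norm_fourierCoeff_le {d : ℕ} {q : ℝ} [Fact (1 ≤ q)] (f : Besicovitch d q)
    (ξ : Fin d → ℝ) : ‖fourierCoeff f ξ‖ ≤ ‖f‖ := by
  induction f using UniformSpace.Completion.induction_on with
  | hp => exact isClosed_le (continuous_fourierCoeff ξ).norm continuous_norm
  | ih S =>
    rw [fourierCoeff_coe, UniformSpace.Completion.norm_coe, norm_trigPoly]
    exact norm_polyCoeff_le Fact.out S.mem ξ

lemma norm_sum_mul_fourierCoeff_le {d : ℕ} {q : ℝ} [Fact (1 ≤ q)] (hq2 : q ≤ 2)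
    (f : Besicovitch d q) (s : Finset (Fin d → ℝ)) (b : (Fin d → ℝ) → ℂ) :
    ‖∑ ξ ∈ s, b ξ * fourierCoeff f ξ‖ ≤ ‖f‖ * (∑ ξ ∈ s, ‖b ξ‖ ^ q) ^ (1 / q) := by
  induction f using UniformSpace.Completion.induction_on with
  | hp =>
    exact isClosed_le (continuous_finsetSum _ fun ξ _ =>
      continuous_const.mul (continuous_fourierCoeff ξ)).norm (continuous_norm.mul continuous_const)
  | ih S =>
    simp only [fourierCoeff_coe, UniformSpace.Completion.norm_coe, norm_trigPoly]
    exact norm_sum_mul_polyCoeff_le Fact.out hq2 S.mem s b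

/-- A finite family whose pairings are bounded on `ℓ^q` is bounded in `ℓ^p`. -/
lemma sum_rpow_le_of_pairing_le {ι : Type*} {p q : ℝ} (hqp : q.HolderConjugate p) (s : Finset ι)
    (a : ι → ℂ) {M : ℝ} (hM : 0 ≤ M)
    (h : ∀ b : ι → ℂ, ‖∑ i ∈ s, b i * a i‖ ≤ M * (∑ i ∈ s, ‖b i‖ ^ q) ^ (1 / q)) :
    ∑ i ∈ s, ‖a i‖ ^ p ≤ M ^ p := by
  set N := ∑ i ∈ s, ‖a i‖ ^ p with hN
  have hN0 : 0 ≤ N := Finset.sum_nonneg fun _ _ => by positivity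
  have hp : 0 < p := hqp.symm.pos
  have hp1 : 1 < p := hqp.symm.lt
  rcases hN0.eq_or_lt with h0 | hNpos
  · rw [← h0]
    positivity
  -- The equality case of Hölder: the pairing is `N`, and since `(p - 1) q = p` the `ℓ^q` norm of
  -- this `b` is `N^{1/q}`. Dividing leaves `N^{1/p} ≤ M`.
  have h1 := h fun i => (starRingEnd ℂ) (a i) * ((‖a i‖ ^ (p - 2) : ℝ) : ℂ)
  have hnorm : ∀ i, ‖(starRingEnd ℂ) (a i) * ((‖a i‖ ^ (p - 2) : ℝ) : ℂ)‖ = ‖a i‖ ^ (p - 1) := by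
    intro i
    rw [norm_mul, RCLike.norm_conj, Complex.norm_real, Real.norm_of_nonneg (by positivity)]
    rcases eq_or_ne (a i) 0 with h0 | h0
    · simp [h0, Real.zero_rpow (sub_pos.2 hp1).ne']
    · rw [show p - 1 = 1 + (p - 2) by ring, Real.rpow_add (norm_pos_iff.2 h0), Real.rpow_one]
  have hprod : ∀ i, (starRingEnd ℂ) (a i) * ((‖a i‖ ^ (p - 2) : ℝ) : ℂ) * a i =
      ((‖a i‖ ^ p : ℝ) : ℂ) := by
    intro i
    rw [mul_right_comm, Complex.conj_mul']
    rcases eq_or_ne (a i) 0 with h0 | h0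
    · simp [h0, Real.zero_rpow hp.ne']
    · rw [← Complex.ofReal_pow, ← Complex.ofReal_mul, ← Real.rpow_natCast,
        ← Real.rpow_add (norm_pos_iff.2 h0)]
      congr 2
      push_cast
      ring
  have hpow : ∀ i, (‖a i‖ ^ (p - 1)) ^ q = ‖a i‖ ^ p := by
    intro i
    rw [← Real.rpow_mul (norm_nonneg _), hqp.symm.sub_one_mul_conj]
  simp only [hnorm, hprod, hpow] at h1
  rw [← Complex.ofReal_sum, Complex.norm_real, Real.norm_of_nonneg hN0] at h1
  have h2 : N ^ (1 / p) ≤ M := by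
    have hNN : N = N ^ (1 / p) * N ^ (1 / q) := by
      rw [← Real.rpow_add hNpos, one_div, one_div, add_comm, hqp.inv_add_inv_eq_one, Real.rpow_one]
    refine le_of_mul_le_mul_right ?_ (Real.rpow_pos_of_pos hNpos (1 / q))
    rw [← hNN]
    exact h1
  calc N = (N ^ (1 / p)) ^ p := by
        rw [← Real.rpow_mul hN0, one_div_mul_cancel hp.ne', Real.rpow_one]
    _ ≤ M ^ p := by gcongr

lemma sum_norm_fourierCoeff_rpow_le {d : ℕ} {p q : ℝ} [Fact (1 ≤ q)]
    (hqp : q.HolderConjugate p) (hq2 : q ≤ 2) (f : Besicovitch d q) (s : Finset (Fin d → ℝ)) :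
    ∑ ξ ∈ s, ‖fourierCoeff f ξ‖ ^ p ≤ ‖f‖ ^ p :=
  sum_rpow_le_of_pairing_le hqp s _ (norm_nonneg _) (norm_sum_mul_fourierCoeff_le hq2 f s)

/-! ### Hölder's inequality and its converse -/

lemma norm_bohrMean_mul_le {d : ℕ} {p q : ℝ} (hqp : q.HolderConjugate p) {S P : (Fin d → ℝ) → ℂ}
    (hS : S ∈ trigPoly d) (hP : P ∈ trigPoly d) :
    ‖bohrMean (S * P)‖ ≤ besicovitchNorm q S * besicovitchNorm p P := by
  have hq0 : 0 < q := hqp.pos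
  have hp0 : 0 < p := hqp.symm.pos
  refine le_of_tendsto_of_tendsto (tendsto_bohrMean (mul_mem hS hP)).norm
    (((tendsto_norm_rpow hq0.le hS).rpow_const (p := 1 / q) (Or.inr (by positivity))).mul
      ((tendsto_norm_rpow hp0.le hP).rpow_const (p := 1 / p) (Or.inr (by positivity)))) ?_
  filter_upwards [eventually_gt_atTop 0] with T hT
  simp only [cubeAvg_eq hT]
  refine (norm_integral_le_integral_norm _).trans ?_
  simp only [Pi.mul_apply, norm_mul]
  exact integral_mul_le_Lp_mul_Lq_of_nonneg hqp (ae_of_all _ fun x => norm_nonneg _)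
    (ae_of_all _ fun x => norm_nonneg _) (memLp_cube hS hT _).norm (memLp_cube hP hT _).norm

lemma bohrMean_norm_rpow_nonneg {d : ℕ} {q : ℝ} (hq : 0 ≤ q) {S : (Fin d → ℝ) → ℂ}
    (hS : S ∈ trigPoly d) : 0 ≤ bohrMean fun x => ‖S x‖ ^ q := by
  refine ge_of_tendsto (tendsto_norm_rpow hq hS) ?_
  filter_upwards [eventually_gt_atTop 0] with T hT
  rw [cubeAvg_eq hT]
  exact integral_nonneg fun x => by positivity

/-- If `|P| ≤ |S|^{q-1} + δ` then `‖P‖_p ≤ ‖S‖_q^{q-1} + δ`. -/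
lemma besicovitchNorm_le_of_norm_le {d : ℕ} {p q : ℝ} (hqp : q.HolderConjugate p)
    {S P : (Fin d → ℝ) → ℂ} (hS : S ∈ trigPoly d) (hP : P ∈ trigPoly d) {δ : ℝ} (hδ : 0 ≤ δ)
    (h : ∀ x, ‖P x‖ ≤ ‖S x‖ ^ (q - 1) + δ) :
    besicovitchNorm p P ≤ besicovitchNorm q S ^ (q - 1) + δ := by
  have hq1 : 0 < q - 1 := sub_pos.2 hqp.lt
  have hp1 : 1 ≤ p := hqp.symm.lt.le
  refine le_of_tendsto_of_tendsto (tendsto_besicovitchNorm hp1 hP)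
    (((tendsto_besicovitchNorm hqp.lt.le hS).rpow_const (p := q - 1) (Or.inr hq1.le)).add_const δ) ?_
  filter_upwards [eventually_gt_atTop 0] with T hT
  have := isProbabilityMeasure_cubeMeasure (d := d) hT
  have hSm := (continuous_of_mem hS).norm.rpow_const (fun _ => Or.inr hq1.le) (p := q - 1)
  have hfin := (memLp_cube hS hT (ENNReal.ofReal q)).eLpNorm_ne_top
  have h1 : eLpNorm P (ENNReal.ofReal p) (cubeMeasure d T) ≤
      eLpNorm S (ENNReal.ofReal q) (cubeMeasure d T) ^ (q - 1) + ENNReal.ofReal δ := by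
    calc _ ≤ eLpNorm ((fun x => ‖S x‖ ^ (q - 1)) + fun _ => δ) (ENNReal.ofReal p)
          (cubeMeasure d T) := eLpNorm_mono_real h
      _ ≤ eLpNorm (fun x => ‖S x‖ ^ (q - 1)) (ENNReal.ofReal p) (cubeMeasure d T) +
          eLpNorm (fun _ => δ) (ENNReal.ofReal p) (cubeMeasure d T) :=
        eLpNorm_add_le hSm.aestronglyMeasurable aestronglyMeasurable_const
          (by simpa using ENNReal.ofReal_le_ofReal hp1)
      _ = _ := by
        -- `(q - 1) p = q` turns the `L^p` norm of `‖S‖^{q-1}` into a power of the `L^q` norm of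
        -- `S`; the constant keeps its value because the measure has mass 1.
        rw [eLpNorm_norm_rpow S hq1, ← ENNReal.ofReal_mul (by linarith), mul_comm p,
          hqp.sub_one_mul_conj, eLpNorm_const _ (by simpa using hqp.symm.pos)
            (NeZero.ne _)]
        simp [Real.enorm_of_nonneg hδ]
  have h2 := ENNReal.toReal_mono (by finiteness) h1
  rwa [ENNReal.toReal_add (by finiteness) (by finiteness), ← ENNReal.toReal_rpow,
    ENNReal.toReal_ofReal hδ] at h2

/-- The approximation of `|S|^{q-2} S̄` by trigonometric polynomials. -/
lemma exists_near_dual {d : ℕ} {q : ℝ} (hq : 2 ≤ q) {S : (Fin d → ℝ) → ℂ} (hS : S ∈ trigPoly d)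
    {C : ℝ} (hC : ∀ x, ‖S x‖ ≤ C) {δ : ℝ} (hδ : 0 < δ) :
    ∃ P ∈ trigPoly d, (∀ x, ‖P x‖ ≤ ‖S x‖ ^ (q - 1) + δ * C) ∧
      ∀ x, ‖S x‖ ^ q ≤ (S x * P x).re + δ * C ^ 2 := by
  have hC0 : 0 ≤ C := (norm_nonneg _).trans (hC 0)
  -- Weierstrass approximation in `t = ‖S x‖²`, where a polynomial in `S S̄` is again trigonometric.
  -- Here `q ≥ 2` makes the power continuous at 0.
  obtain ⟨g, hg⟩ := exists_polynomial_near_of_continuousOn 0 (C ^ 2) (fun t => t ^ ((q - 2) / 2))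
    (Real.continuous_rpow_const (by linarith)).continuousOn δ hδ
  set N : (Fin d → ℝ) → ℂ := S * fun x => (starRingEnd ℂ) (S x) with hN
  have hNm : N ∈ trigPoly d := mul_mem hS (conj_mem hS)
  have hNx : ∀ x, N x = ((‖S x‖ ^ 2 : ℝ) : ℂ) := fun x => by
    simp [hN, Complex.mul_conj, Complex.normSq_eq_norm_sq]
  set R : (Fin d → ℝ) → ℂ := ∑ i ∈ g.support, (g.coeff i : ℂ) • N ^ i with hR
  have hRm : R ∈ trigPoly d :=
    Submodule.sum_mem _ fun i _ => Submodule.smul_mem _ _ (pow_mem hNm i)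
  have hRx : ∀ x, R x = ((g.eval (‖S x‖ ^ 2) : ℝ) : ℂ) := fun x => by
    rw [hR, Polynomial.eval_eq_sum, Polynomial.sum_def]
    simp [Finset.sum_apply, hNx]
  have hgx : ∀ x, |g.eval (‖S x‖ ^ 2) - ‖S x‖ ^ (q - 2)| < δ := fun x => by
    have h1 := hg (‖S x‖ ^ 2) ⟨by positivity, by gcongr; exact hC x⟩
    have h2 : (‖S x‖ ^ 2) ^ ((q - 2) / 2) = ‖S x‖ ^ (q - 2) := by
      rw [← Real.rpow_natCast, ← Real.rpow_mul (norm_nonneg _)]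
      congr 1
      push_cast
      ring
    simpa only [h2] using h1
  refine ⟨R * fun x => (starRingEnd ℂ) (S x), mul_mem hRm (conj_mem hS), fun x => ?_, fun x => ?_⟩
  · have h1 : ‖S x‖ ^ (q - 1) = ‖S x‖ ^ (q - 2) * ‖S x‖ := by
      rw [← Real.rpow_add_one' (norm_nonneg _) (by linarith)]
      congr 1
      ring
    rw [Pi.mul_apply, norm_mul, RCLike.norm_conj, hRx, Complex.norm_real, Real.norm_eq_abs, h1]
    have h2 : |g.eval (‖S x‖ ^ 2)| ≤ ‖S x‖ ^ (q - 2) + δ := by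
      have h3 := abs_sub_abs_le_abs_sub (g.eval (‖S x‖ ^ 2)) (‖S x‖ ^ (q - 2))
      rw [abs_of_nonneg (by positivity : 0 ≤ ‖S x‖ ^ (q - 2))] at h3
      linarith [hgx x]
    calc _ ≤ (‖S x‖ ^ (q - 2) + δ) * ‖S x‖ := by gcongr
      _ = ‖S x‖ ^ (q - 2) * ‖S x‖ + δ * ‖S x‖ := by ring
      _ ≤ _ := by gcongr; exact hC x
  · have h1 : ‖S x‖ ^ q = ‖S x‖ ^ (q - 2) * ‖S x‖ ^ 2 := by
      rw [← Real.rpow_natCast, ← Real.rpow_add' (norm_nonneg _) (by push_cast; linarith)]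
      congr 1
      push_cast
      ring
    have h2 : (S x * (R * fun x => (starRingEnd ℂ) (S x)) x).re =
        g.eval (‖S x‖ ^ 2) * ‖S x‖ ^ 2 := by
      rw [Pi.mul_apply, mul_left_comm, Complex.mul_conj', hRx, ← Complex.ofReal_pow,
        ← Complex.ofReal_mul, Complex.ofReal_re]
    rw [h1, h2]
    have h3 := (abs_lt.1 (hgx x)).1
    calc _ ≤ (g.eval (‖S x‖ ^ 2) + δ) * ‖S x‖ ^ 2 := by gcongr; linarith
      _ = g.eval (‖S x‖ ^ 2) * ‖S x‖ ^ 2 + δ * ‖S x‖ ^ 2 := by ring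
      _ ≤ _ := by gcongr; exact hC x

/-- The norm `‖S‖_q` is at most the norm of the functional `P ↦ 𝓜(S P)` for `‖·‖_p`. -/
lemma besicovitchNorm_le_of_dual {d : ℕ} {p q : ℝ} (hq : 2 ≤ q) (hqp : q.HolderConjugate p)
    {S : (Fin d → ℝ) → ℂ} (hS : S ∈ trigPoly d) {M : ℝ} (hM : 0 ≤ M)
    (h : ∀ P ∈ trigPoly d, ‖bohrMean (S * P)‖ ≤ M * besicovitchNorm p P) :
    besicovitchNorm q S ≤ M := by
  have hq0 : 0 < q := by linarith
  obtain ⟨C, hC⟩ := bounded_of_mem hS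
  have hC0 : 0 ≤ C := (norm_nonneg _).trans (hC 0)
  set N := besicovitchNorm q S with hN
  have hm0 := bohrMean_norm_rpow_nonneg hq0.le hS
  have hN0 : 0 ≤ N := Real.rpow_nonneg hm0 _
  have hNq : N ^ q = bohrMean fun x => ‖S x‖ ^ q := by
    rw [hN, besicovitchNorm, ← Real.rpow_mul hm0, one_div_mul_cancel hq0.ne', Real.rpow_one]
  -- Testing against the approximate extremizer; as `δ → 0` this becomes `N^q ≤ M N^{q-1}`.
  have hδ : ∀ δ > 0, N ^ q ≤ M * (N ^ (q - 1) + δ * C) + δ * C ^ 2 := by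
    intro δ hδ
    obtain ⟨P, hP, hP1, hP2⟩ := exists_near_dual hq hS hC hδ
    have hSP := mul_mem hS hP
    have h1 : N ^ q ≤ (bohrMean (S * P)).re + δ * C ^ 2 := by
      rw [hNq]
      refine le_of_tendsto_of_tendsto (tendsto_norm_rpow hq0.le hS)
        (((Complex.continuous_re.tendsto _).comp (tendsto_bohrMean hSP)).add_const _) ?_
      filter_upwards [eventually_gt_atTop 0] with T hT
      have := isProbabilityMeasure_cubeMeasure (d := d) hT
      have hi := integrable_cube (continuous_of_mem hSP) T
      have hre : (∫ x, (S * P) x ∂(cubeMeasure d T)).re =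
          ∫ x, ((S * P) x).re ∂(cubeMeasure d T) := (integral_re hi).symm
      rw [Function.comp, cubeAvg_eq hT, cubeAvg_eq hT, hre]
      have hle : ∫ x, ‖S x‖ ^ q ∂(cubeMeasure d T) ≤
          ∫ x, (((S * P) x).re + δ * C ^ 2) ∂(cubeMeasure d T) :=
        integral_mono
          (integrable_cube ((continuous_of_mem hS).norm.rpow_const fun _ => Or.inr hq0.le) T)
          (hi.re.add (integrable_const _)) hP2
      have hadd : ∫ x, (((S * P) x).re + δ * C ^ 2) ∂(cubeMeasure d T) =
          ∫ x, ((S * P) x).re ∂(cubeMeasure d T) + δ * C ^ 2 := by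
        refine (integral_add hi.re (integrable_const _)).trans ?_
        simp
      exact hle.trans_eq hadd
    calc N ^ q ≤ ‖bohrMean (S * P)‖ + δ * C ^ 2 :=
          h1.trans (by gcongr; exact Complex.re_le_norm _)
      _ ≤ M * besicovitchNorm p P + δ * C ^ 2 := by gcongr; exact h P hP
      _ ≤ _ := by
        gcongr
        exact besicovitchNorm_le_of_norm_le hqp hS hP (by positivity) hP1
  have hlim : Tendsto (fun δ : ℝ => M * (N ^ (q - 1) + δ * C) + δ * C ^ 2) (𝓝[>] 0)
      (𝓝 (M * N ^ (q - 1))) := by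
    have : Continuous fun δ : ℝ => M * (N ^ (q - 1) + δ * C) + δ * C ^ 2 := by fun_prop
    simpa using (this.tendsto 0).mono_left nhdsWithin_le_nhds
  have hfin : N ^ q ≤ M * N ^ (q - 1) :=
    ge_of_tendsto hlim (eventually_mem_nhdsWithin.mono hδ)
  rcases hN0.eq_or_lt with h0 | hpos
  · rw [← h0]
    exact hM
  · refine le_of_mul_le_mul_right ?_ (Real.rpow_pos_of_pos hpos (q - 1))
    rwa [← Real.rpow_one_add' hN0 (by linarith), add_sub_cancel]

/-! ### The two inequalities for `B^q_ap` -/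

lemma tsum_spectrum {d : ℕ} {q p : ℝ} [Fact (1 ≤ q)] (hp : 0 < p) (f : Besicovitch d q) :
    ∑' ξ : spectrum f, ‖fourierCoeff f ξ‖ₑ ^ p = ∑' ξ, ‖fourierCoeff f ξ‖ₑ ^ p := by
  refine tsum_subtype_eq_of_support_subset (f := fun ξ => ‖fourierCoeff f ξ‖ₑ ^ p) fun ξ hξ => ?_
  rw [Function.mem_support] at hξ
  intro h0
  exact hξ (by simp [h0, hp])

lemma ellNorm_ofReal_eq {d : ℕ} {q p : ℝ} [Fact (1 ≤ q)] (hp : 0 < p) (f : Besicovitch d q) :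
    ellNorm (ENNReal.ofReal p) (fun ξ : spectrum f => fourierCoeff f ξ) =
      (∑' ξ, ‖fourierCoeff f ξ‖ₑ ^ p) ^ (1 / p) := by
  rw [ellNorm, if_neg ENNReal.ofReal_ne_top, ENNReal.toReal_ofReal hp.le, tsum_spectrum hp]

lemma sum_enorm_rpow_eq {ι : Type*} {p : ℝ} (hp : 0 ≤ p) (s : Finset ι) (a : ι → ℂ) :
    ∑ i ∈ s, ‖a i‖ₑ ^ p = ENNReal.ofReal (∑ i ∈ s, ‖a i‖ ^ p) := by
  rw [ENNReal.ofReal_sum_of_nonneg fun _ _ => by positivity]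
  refine Finset.sum_congr rfl fun i _ => ?_
  rw [← ENNReal.ofReal_rpow_of_nonneg (norm_nonneg _) hp, ofReal_norm]

/-- The Hausdorff-Young inequality for Besicovitch almost periodic functions, `1 < q ≤ 2`. -/
lemma ellNorm_fourierCoeff_le {d : ℕ} {p q : ℝ} [Fact (1 ≤ q)] (hqp : q.HolderConjugate p)
    (hq2 : q ≤ 2) (f : Besicovitch d q) :
    ellNorm (ENNReal.ofReal p) (fun ξ : spectrum f => fourierCoeff f ξ) ≤ ENNReal.ofReal ‖f‖ := by
  have hp : 0 < p := hqp.symm.pos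
  rw [ellNorm_ofReal_eq hp, one_div, ENNReal.rpow_inv_le_iff hp, ENNReal.tsum_eq_iSup_sum,
    ENNReal.ofReal_rpow_of_nonneg (norm_nonneg _) hp.le]
  refine iSup_le fun s => ?_
  rw [sum_enorm_rpow_eq hp.le]
  exact ENNReal.ofReal_le_ofReal (sum_norm_fourierCoeff_rpow_le hqp hq2 f s)

lemma rpow_sum_le_ellNorm {d : ℕ} {p q : ℝ} [Fact (1 ≤ q)] (hp : 0 < p) (f : Besicovitch d q)
    (hfin : ellNorm (ENNReal.ofReal p) (fun ξ : spectrum f => fourierCoeff f ξ) ≠ ∞)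
    (s : Finset (Fin d → ℝ)) :
    (∑ ξ ∈ s, ‖fourierCoeff f ξ‖ ^ p) ^ (1 / p) ≤
      (ellNorm (ENNReal.ofReal p) (fun ξ : spectrum f => fourierCoeff f ξ)).toReal := by
  rw [← ENNReal.ofReal_le_iff_le_toReal hfin, ellNorm_ofReal_eq hp,
    ← ENNReal.ofReal_rpow_of_nonneg (Finset.sum_nonneg fun _ _ => by positivity) (by positivity),
    ← sum_enorm_rpow_eq hp.le]
  gcongr
  exact ENNReal.sum_le_tsum s

open scoped Pointwise in
/-- The pairing of `f` with a trigonometric polynomial is bounded by the `ℓ^p` norm of `f̂`. -/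
lemma norm_pairing_le_ellNorm {d : ℕ} {p q : ℝ} [Fact (1 ≤ q)] (hq : 2 ≤ q)
    (hqp : q.HolderConjugate p) (f : Besicovitch d q)
    (hfin : ellNorm (ENNReal.ofReal p) (fun ξ : spectrum f => fourierCoeff f ξ) ≠ ∞)
    {P : (Fin d → ℝ) → ℂ} (hP : P ∈ trigPoly d) (s : Finset (Fin d → ℝ)) :
    ‖∑ ξ ∈ s, polyCoeff P ξ * fourierCoeff f (-ξ)‖ ≤
      (ellNorm (ENNReal.ofReal p) (fun ξ : spectrum f => fourierCoeff f ξ)).toReal *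
        besicovitchNorm p P := by
  classical
  have hp1 : Fact (1 ≤ p) := ⟨hqp.symm.lt.le⟩
  have hp2 : p ≤ 2 := by
    have h1 := hqp.sub_one_mul_conj
    have h2 := hqp.symm.pos
    nlinarith
  -- The pairing evaluates `f̂` at the reflected frequencies.
  have hA := rpow_sum_le_ellNorm hqp.symm.pos f hfin (-s)
  rw [Finset.sum_neg_index] at hA
  -- The roles of the exponents are exchanged: part (a) is used in the space of order `p ≤ 2`, whose
  -- conjugate exponent is `q`.
  let P' : TrigPoly d p := ⟨P, hP⟩
  have hP' : (∑ ξ ∈ s, ‖polyCoeff P ξ‖ ^ q) ^ (1 / q) ≤ besicovitchNorm p P := by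
    have h1 := sum_norm_fourierCoeff_rpow_le hqp.symm hp2 (P' : Besicovitch d p) s
    simp only [fourierCoeff_coe] at h1
    have h2 : ‖(P' : Besicovitch d p)‖ = besicovitchNorm p P := by
      rw [UniformSpace.Completion.norm_coe, norm_trigPoly]
      rfl
    rw [← h2, one_div, Real.rpow_inv_le_iff_of_pos (Finset.sum_nonneg fun _ _ => by positivity)
      (norm_nonneg _) hqp.pos]
    exact h1
  refine (norm_sum_le _ _).trans ?_
  simp only [norm_mul]
  refine (Real.inner_le_Lp_mul_Lq_of_nonneg s hqp (fun _ _ => norm_nonneg _)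
    fun _ _ => norm_nonneg _).trans ?_
  rw [mul_comm]
  gcongr

/-- Both sides are continuous in `f`, so `f` may be taken to be a polynomial `R`; the claim is then
Hölder for `(S - R) P`. -/
lemma norm_pairing_sub_le {d : ℕ} {p q : ℝ} [Fact (1 ≤ q)] (hqp : q.HolderConjugate p)
    {P : (Fin d → ℝ) → ℂ} (hP : P ∈ trigPoly d) {s : Finset (Fin d → ℝ)}
    {c : (Fin d → ℝ) → ℂ} (hs : P = ∑ ξ ∈ s, c ξ • character ξ) (f : Besicovitch d q)
    (S : TrigPoly d q) :
    ‖bohrMean (S.toFun * P) - ∑ ξ ∈ s, c ξ * fourierCoeff f (-ξ)‖ ≤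
      ‖(S : Besicovitch d q) - f‖ * besicovitchNorm p P := by
  induction f using UniformSpace.Completion.induction_on with
  | hp =>
    exact isClosed_le (continuous_const.sub (continuous_finsetSum _ fun ξ _ =>
      continuous_const.mul (continuous_fourierCoeff (-ξ)))).norm
      ((continuous_const.sub continuous_id).norm.mul continuous_const)
  | ih R =>
    simp only [fourierCoeff_coe]
    have h1 : S.toFun * P - R.toFun * P = (S - R).toFun * P := (sub_mul _ _ _).symm
    have h2 : bohrMean ((S - R).toFun * P) = bohrMean (S.toFun * P) - bohrMean (R.toFun * P) := by
      rw [← h1, sub_eq_add_neg, ← neg_one_smul ℂ, bohrMean_add (mul_mem S.mem hP)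
        ((trigPoly d).smul_mem _ (mul_mem R.mem hP)), bohrMean_smul _ (mul_mem R.mem hP)]
      ring
    rw [← bohrMean_mul_eq_sum R.mem hs, ← h2, ← UniformSpace.Completion.coe_sub,
      UniformSpace.Completion.norm_coe, norm_trigPoly]
    exact norm_bohrMean_mul_le hqp (S - R).mem hP

/-- The dual Hausdorff-Young inequality for Besicovitch almost periodic functions, `2 ≤ q`. -/
lemma norm_le_ellNorm_fourierCoeff {d : ℕ} {p q : ℝ} [Fact (1 ≤ q)] (hqp : q.HolderConjugate p)
    (hq : 2 ≤ q) (f : Besicovitch d q) :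
    ENNReal.ofReal ‖f‖ ≤ ellNorm (ENNReal.ofReal p) fun ξ : spectrum f => fourierCoeff f ξ := by
  by_cases hfin : ellNorm (ENNReal.ofReal p) (fun ξ : spectrum f => fourierCoeff f ξ) = ∞
  · rw [hfin]
    exact le_top
  rw [ENNReal.ofReal_le_iff_le_toReal hfin]
  set A := (ellNorm (ENNReal.ofReal p) fun ξ : spectrum f => fourierCoeff f ξ).toReal with hA
  have hA0 : 0 ≤ A := ENNReal.toReal_nonneg
  refine le_of_forall_pos_le_add fun ε hε => ?_
  obtain ⟨S, hS⟩ : ∃ S : TrigPoly d q, ‖(S : Besicovitch d q) - f‖ < ε / 2 := by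
    have := Metric.denseRange_iff.1
      (UniformSpace.Completion.denseRange_coe (α := TrigPoly d q)) f (ε / 2) (by positivity)
    obtain ⟨S, hS⟩ := this
    exact ⟨S, by rwa [dist_comm, dist_eq_norm] at hS⟩
  have hSn : besicovitchNorm q S.toFun ≤ A + ε / 2 := by
    -- `A` comes from the pairing of `P` with `f`, and `ε / 2` from replacing `f` by `S`.
    refine besicovitchNorm_le_of_dual hq hqp S.mem (by positivity) fun P hP => ?_
    obtain ⟨s, hs⟩ := exists_fourier_expansion hP
    have h1 := norm_pairing_sub_le hqp hP hs f S
    have h2 := norm_pairing_le_ellNorm hq hqp f hfin hP s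
    have hP0 : 0 ≤ besicovitchNorm p P :=
      Real.rpow_nonneg (bohrMean_norm_rpow_nonneg hqp.symm.nonneg hP) _
    have h3 := norm_le_norm_add_norm_sub' (bohrMean (S.toFun * P))
      (∑ ξ ∈ s, polyCoeff P ξ * fourierCoeff f (-ξ))
    have h4 := mul_le_mul_of_nonneg_right hS.le hP0
    rw [add_mul]
    linarith
  have h5 : ‖(S : Besicovitch d q)‖ ≤ A + ε / 2 := by
    rwa [UniformSpace.Completion.norm_coe, norm_trigPoly]
  have h6 := norm_le_norm_add_norm_sub (S : Besicovitch d q) f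
  linarith

end BesicovitchAP

theorem theorem1p5 (d : ℕ) (q : ℝ) [Fact (1 ≤ q)] (q' : ℝ≥0∞)
    (hq' : q' = ENNReal.ofReal q / (ENNReal.ofReal q - 1)) (f : BesicovitchAP.Besicovitch d q) :
    (q ≤ 2 →
      BesicovitchAP.ellNorm q'
        (fun ξ : BesicovitchAP.spectrum f => BesicovitchAP.fourierCoeff f ξ) ≤
          ENNReal.ofReal ‖f‖) ∧
    (2 ≤ q →
      ENNReal.ofReal ‖f‖ ≤
        BesicovitchAP.ellNorm q'
          (fun ξ : BesicovitchAP.spectrum f => BesicovitchAP.fourierCoeff f ξ)) := by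
  have hq1 : 1 ≤ q := Fact.out
  rcases hq1.eq_or_lt with h1 | h1
  · refine ⟨fun _ => ?_, fun h2 => by linarith⟩
    -- In `ℝ≥0∞` the quotient `1 / 0` is `∞`, the intended conjugate exponent of 1.
    have hq'top : q' = ∞ := by
      rw [hq', ← h1, ENNReal.ofReal_one, tsub_self, ENNReal.div_zero one_ne_zero]
    rw [BesicovitchAP.ellNorm, if_pos hq'top]
    refine iSup_le fun ξ => ?_
    rw [← ofReal_norm]
    exact ENNReal.ofReal_le_ofReal (BesicovitchAP.norm_fourierCoeff_le f ξ)
  · have hqp : q.HolderConjugate (q / (q - 1)) := Real.HolderConjugate.conjExponent h1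
    have hq'p : q' = ENNReal.ofReal (q / (q - 1)) := by
      rw [hq', ENNReal.ofReal_div_of_pos (sub_pos.2 h1), ENNReal.ofReal_sub _ zero_le_one,
        ENNReal.ofReal_one]
    rw [hq'p]
    exact ⟨fun h2 => BesicovitchAP.ellNorm_fourierCoeff_le hqp h2 f,
      fun h2 => BesicovitchAP.norm_le_ellNorm_fourierCoeff hqp h2 f⟩
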